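/- Let $d\ge 1$, let $1<p<2$, and let $p'$ be the conjugate exponent, $\frac1p+\frac1{p'}=1$. All functions are complex-valued, and $\mathbb{R}^d$ carries Lebesgue measure $\mu$. For $0<q,r<\infty$ the Lorentz space $L^{q,r}(\mathbb{R}^d)$ consists of the measurable functions $f$ (modulo equality almost everywhere) with \[ \|f\|_{q,r}=q^{1/r}\Big(\int_0^\infty t^{r-1}\,\mu\{x:|f(x)|>t\}^{r/q}\,dt\Big)^{1/r}<\infty . \] The Fourier transform \[ \mathscr F f(x)=\int_{\mathbb{R}^d} f(t)\,e^{-i\langle x,t\rangle}\,dt ,\qquad f\in L^1(\mathbb{R}^d)\cap L^p(\mathbb{R}^d), \] extends uniquely to a bounded linear operator $\mathscr F:L^p(\mathbb{R}^d)\to L^{p',p}(\mathbb{R}^d)$, and this operator is not strictly singular: there is an infinite-dimensional subspace $Z\subseteq L^p(\mathbb{R}^d)$ such that the restriction $\mathscr F|_Z$ is an isomorphism from $Z$ onto $\mathscr F(Z)$, that is, $\|\mathscr F f\|_{p',p}\ge c\,\|f\|_p$ for all $f\in Z$ with some constant $c>0$. -/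

import Mathlib

open MeasureTheory Set
open scoped ENNReal

noncomputable section

/-! ### Lorentz spaces -/

section Lorentz

variable {α : Type*} [MeasurableSpace α]

/-- The integral `∫₀^∞ t^(r-1) μ{x : ‖f x‖ > t}^(r/p) dt`. -/
def lorentzIntegral (p r : ℝ) (μ : Measure α) (f : α → ℂ) : ℝ≥0∞ :=
  ∫⁻ t in Ioi (0 : ℝ), ENNReal.ofReal (t ^ (r - 1)) * μ {x | t < ‖f x‖} ^ (r / p)

/-- The Lorentz functional
`‖f‖_{L^{p,r}(μ)} = p^(1/r) (∫₀^∞ t^(r-1) μ{x : ‖f x‖ > t}^(r/p) dt)^(1/r)`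
(for `0 < p < ∞` and `0 < r < ∞`), with values in `[0, ∞]`. -/
def lorentzENorm (p r : ℝ) (μ : Measure α) (f : α → ℂ) : ℝ≥0∞ :=
  ENNReal.ofReal (p ^ (1 / r)) * lorentzIntegral p r μ f ^ (1 / r)

theorem lorentzENorm_lt_top_iff {p r : ℝ} (hp : 0 < p) (hr : 0 < r) (μ : Measure α) (f : α → ℂ) :
    lorentzENorm p r μ f < ⊤ ↔ lorentzIntegral p r μ f < ⊤ := by
  have h1 : 0 < 1 / r := by positivity
  have h2 : ENNReal.ofReal (p ^ (1 / r)) ≠ 0 := by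
    rw [Ne, ENNReal.ofReal_eq_zero, not_le]
    positivity
  unfold lorentzENorm
  constructor
  · intro h
    by_contra hc
    rw [not_lt, top_le_iff] at hc
    rw [hc, ENNReal.top_rpow_of_pos h1, ENNReal.mul_top h2] at h
    exact lt_irrefl _ h
  · intro h
    exact ENNReal.mul_lt_top ENNReal.ofReal_lt_top (ENNReal.rpow_lt_top_of_nonneg h1.le h.ne)

theorem lorentzIntegral_congr_ae (p r : ℝ) {μ : Measure α} {f g : α → ℂ} (h : f =ᵐ[μ] g) :
    lorentzIntegral p r μ f = lorentzIntegral p r μ g := by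
  unfold lorentzIntegral
  congr 1
  ext t
  have : μ {x | t < ‖f x‖} = μ {x | t < ‖g x‖} := by
    apply measure_congr
    filter_upwards [h] with x hx
    exact congrArg (fun z : ℂ => t < ‖z‖) hx
  rw [this]

theorem lorentzIntegral_zero {p r : ℝ} (hp : 0 < p) (hr : 0 < r) (μ : Measure α) :
    lorentzIntegral p r μ 0 = 0 := by
  unfold lorentzIntegral
  have hrp : 0 < r / p := by positivity
  rw [setLIntegral_congr_fun (g := fun _ => 0) measurableSet_Ioi]
  · simp
  · intro t ht
    have : {x : α | t < ‖(0 : α → ℂ) x‖} = ∅ := by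
      ext x
      simpa using (le_of_lt ht : (0 : ℝ) ≤ t)
    simp only [this, measure_empty, ENNReal.zero_rpow_of_pos hrp, mul_zero]

/-- Dilation of the variable in the integrals that define the Lorentz functional. -/
theorem lorentzIntegral_dilate_lt_top {r a : ℝ} (ha : 0 < a) {F : ℝ → ℝ≥0∞}
    (h : ∫⁻ t in Ioi (0 : ℝ), ENNReal.ofReal (t ^ (r - 1)) * F t < ⊤) :
    ∫⁻ t in Ioi (0 : ℝ), ENNReal.ofReal (t ^ (r - 1)) * F (a * t) < ⊤ := by
  have him : (fun t : ℝ => a * t) '' Ioi 0 = Ioi 0 := by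
    rw [image_mul_left_Ioi ha, mul_zero]
  have key := lintegral_image_eq_lintegral_abs_deriv_mul (s := Ioi (0 : ℝ))
    (f := fun t : ℝ => a * t) (f' := fun _ => a) measurableSet_Ioi
    (fun x _ => by simpa using ((hasDerivAt_id x).const_mul a).hasDerivWithinAt)
    (fun x _ y _ hxy => mul_left_cancel₀ ha.ne' hxy)
    (fun t => ENNReal.ofReal (t ^ (r - 1)) * F t)
  rw [him] at key
  rw [key] at h
  have hcongr : ∫⁻ t in Ioi (0 : ℝ), ENNReal.ofReal |a| *
        (ENNReal.ofReal ((a * t) ^ (r - 1)) * F (a * t)) =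
      ∫⁻ t in Ioi (0 : ℝ), ENNReal.ofReal (a * a ^ (r - 1)) *
        (ENNReal.ofReal (t ^ (r - 1)) * F (a * t)) := by
    refine setLIntegral_congr_fun measurableSet_Ioi fun t ht => ?_
    have ht' : (0 : ℝ) ≤ t := le_of_lt ht
    rw [abs_of_pos ha, Real.mul_rpow ha.le ht',
      ENNReal.ofReal_mul (Real.rpow_nonneg ha.le _), ENNReal.ofReal_mul ha.le]
    ring
  rw [hcongr, lintegral_const_mul' _ _ ENNReal.ofReal_ne_top] at h
  have hpos : ENNReal.ofReal (a * a ^ (r - 1)) ≠ 0 := by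
    rw [Ne, ENNReal.ofReal_eq_zero, not_le]
    positivity
  exact ENNReal.lt_top_of_mul_ne_top_right h.ne hpos

theorem lorentzIntegral_smul_lt_top {p r : ℝ} (hp : 0 < p) (hr : 0 < r) (μ : Measure α) (c : ℂ)
    {f : α → ℂ} (hf : lorentzIntegral p r μ f < ⊤) : lorentzIntegral p r μ (c • f) < ⊤ := by
  by_cases hc : c = 0
  · rw [hc, zero_smul, lorentzIntegral_zero hp hr]
    exact ENNReal.zero_lt_top
  have hc' : 0 < ‖c‖ := norm_pos_iff.mpr hc
  have h := lorentzIntegral_dilate_lt_top (inv_pos.mpr hc') hf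
  unfold lorentzIntegral
  convert! h using 6 with t
  ext x
  simp only [mem_ofPred_eq, Pi.smul_apply, smul_eq_mul, norm_mul]
  rw [inv_mul_lt_iff₀ hc']

theorem lorentzIntegral_add_lt_top {p r : ℝ} (hp : 0 < p) (hr : 0 < r) {μ : Measure α}
    {f g : α → ℂ} (hf : lorentzIntegral p r μ f < ⊤) (hg : lorentzIntegral p r μ g < ⊤) :
    lorentzIntegral p r μ (f + g) < ⊤ := by
  have h2 : (0 : ℝ) < 2⁻¹ := by norm_num
  have hs : 0 ≤ r / p := by positivity
  have hf' := lorentzIntegral_dilate_lt_top h2 hf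
  have hg' := lorentzIntegral_dilate_lt_top h2 hg
  have hmeas : Measurable fun t : ℝ =>
      ENNReal.ofReal (t ^ (r - 1)) * μ {x | 2⁻¹ * t < ‖f x‖} ^ (r / p) := by
    refine Measurable.mul (by fun_prop) (Measurable.pow_const (Antitone.measurable ?_) _)
    intro s t hst
    exact measure_mono fun x (hx : 2⁻¹ * t < ‖f x‖) =>
      lt_of_le_of_lt (mul_le_mul_of_nonneg_left hst h2.le) hx
  have hbound : lorentzIntegral p r μ (f + g) ≤
      (2 : ℝ≥0∞) ^ (r / p) * ∫⁻ t in Ioi (0 : ℝ),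
        (ENNReal.ofReal (t ^ (r - 1)) * μ {x | 2⁻¹ * t < ‖f x‖} ^ (r / p) +
          ENNReal.ofReal (t ^ (r - 1)) * μ {x | 2⁻¹ * t < ‖g x‖} ^ (r / p)) := by
    rw [← lintegral_const_mul' _ _ (ENNReal.rpow_ne_top_of_nonneg hs (by simp))]
    refine lintegral_mono fun t => ?_
    have hsub : {x | t < ‖(f + g) x‖} ⊆ {x | 2⁻¹ * t < ‖f x‖} ∪ {x | 2⁻¹ * t < ‖g x‖} := by
      intro x hx
      by_contra hcon
      simp only [mem_union, mem_ofPred_eq, not_or, not_lt] at hcon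
      have h1 : t < ‖f x + g x‖ := hx
      have h3 := norm_add_le (f x) (g x)
      linarith [hcon.1, hcon.2]
    set A := μ {x | 2⁻¹ * t < ‖f x‖}
    set B := μ {x | 2⁻¹ * t < ‖g x‖}
    have hAB : μ {x | t < ‖(f + g) x‖} ≤ 2 * max A B := by
      refine (measure_mono hsub).trans ((measure_union_le _ _).trans ?_)
      rw [two_mul]
      exact add_le_add (le_max_left _ _) (le_max_right _ _)
    have hmax : (max A B) ^ (r / p) ≤ A ^ (r / p) + B ^ (r / p) := by
      rcases le_total A B with h | h
      · rw [max_eq_right h]; exact le_add_self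
      · rw [max_eq_left h]; exact le_self_add
    calc ENNReal.ofReal (t ^ (r - 1)) * μ {x | t < ‖(f + g) x‖} ^ (r / p)
        ≤ ENNReal.ofReal (t ^ (r - 1)) * (2 ^ (r / p) * (A ^ (r / p) + B ^ (r / p))) := by
          gcongr
          refine (ENNReal.rpow_le_rpow hAB hs).trans ?_
          rw [ENNReal.mul_rpow_of_nonneg _ _ hs]
          gcongr
      _ = _ := by ring
  refine lt_of_le_of_lt hbound ?_
  rw [lintegral_add_left hmeas]
  exact ENNReal.mul_lt_top (ENNReal.rpow_lt_top_of_nonneg hs (by simp))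
    (ENNReal.add_lt_top.mpr ⟨hf', hg'⟩)

/-- The Lorentz space `L^{p,r}(μ)`, `0 < p < ∞`, `0 < r < ∞`, of (classes modulo equality almost
everywhere of) complex-valued measurable functions. -/
def LorentzSpace (p r : ℝ) (hp : 0 < p) (hr : 0 < r) (μ : Measure α) :
    Submodule ℂ (α →ₘ[μ] ℂ) where
  carrier := {f | lorentzENorm p r μ f < ⊤}
  add_mem' {f g} hf hg := by
    simp only [mem_ofPred_eq, lorentzENorm_lt_top_iff hp hr] at hf hg ⊢
    rw [lorentzIntegral_congr_ae p r (AEEqFun.coeFn_add f g)]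
    exact lorentzIntegral_add_lt_top hp hr hf hg
  zero_mem' := by
    simp only [mem_ofPred_eq, lorentzENorm_lt_top_iff hp hr]
    rw [lorentzIntegral_congr_ae p r AEEqFun.coeFn_zero, lorentzIntegral_zero hp hr]
    exact ENNReal.zero_lt_top
  smul_mem' c f hf := by
    simp only [mem_ofPred_eq, lorentzENorm_lt_top_iff hp hr] at hf ⊢
    rw [lorentzIntegral_congr_ae p r (AEEqFun.coeFn_smul c f)]
    exact lorentzIntegral_smul_lt_top hp hr μ c hf

/-- The (quasi-)norm of the Lorentz space. -/
instance LorentzSpace.instNorm (p r : ℝ) (hp : 0 < p) (hr : 0 < r) (μ : Measure α) :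
    Norm (LorentzSpace p r hp hr μ) where
  norm f := (lorentzENorm p r μ (f : α →ₘ[μ] ℂ)).toReal

end Lorentz

/-! ### Strictly singular operators -/

section StrictlySingular

variable {X Y : Type*} [AddCommMonoid X] [Module ℂ X] [Norm X]
  [AddCommMonoid Y] [Module ℂ Y] [Norm Y]

/-- The linear map `T` between (quasi-)normed spaces is bounded. -/
def IsBoundedOperator (T : X →ₗ[ℂ] Y) : Prop :=
  ∃ C : ℝ, ∀ x : X, ‖T x‖ ≤ C * ‖x‖

/-- The restriction of `T` to the subspace `Z` is an isomorphism (of (quasi-)normed spaces) from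
`Z` onto `T(Z)`: it is bounded, and it is injective with a bounded inverse `T(Z) → Z`. -/
def IsIsomorphismOn (T : X →ₗ[ℂ] Y) (Z : Submodule ℂ X) : Prop :=
  ∃ c C : ℝ, 0 < c ∧ ∀ x ∈ Z, c * ‖x‖ ≤ ‖T x‖ ∧ ‖T x‖ ≤ C * ‖x‖

/-- `T` is strictly singular: there is no infinite-dimensional subspace `Z` such that `T|_Z` is an
isomorphism from `Z` onto `T(Z)`. -/
def IsStrictlySingular (T : X →ₗ[ℂ] Y) : Prop :=
  ¬ ∃ Z : Submodule ℂ X, ¬ Module.Finite ℂ Z ∧ IsIsomorphismOn T Z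

end StrictlySingular

/-! ### The Fourier transform -/

/-- The Fourier integral `∫ f(t) e^{-i⟨x,t⟩} dt` of a function `f` on `ℝ^d`. -/
def fourierIntegralRd {d : ℕ} (f : EuclideanSpace ℝ (Fin d) → ℂ) (x : EuclideanSpace ℝ (Fin d)) :
    ℂ :=
  ∫ t, f t * Complex.exp (-Complex.I * ((inner ℝ x t : ℝ) : ℂ))

/-- The linear map `T` is the Fourier transform from `L^s(ℝ^d)` to `L^{p,r}(ℝ^d)`: it is bounded,
and on `L^1 ∩ L^s` (which is dense in `L^s` for `1 ≤ s < ∞`) it is given by the Fourier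
integral. -/
structure IsFourierTransform {d : ℕ} {s : ℝ≥0∞} {p r : ℝ} {hp : 0 < p} {hr : 0 < r}
    (T : Lp ℂ s (volume : Measure (EuclideanSpace ℝ (Fin d))) →ₗ[ℂ]
      LorentzSpace p r hp hr (volume : Measure (EuclideanSpace ℝ (Fin d)))) : Prop where
  bounded : IsBoundedOperator T
  eq_integral : ∀ f : Lp ℂ s (volume : Measure (EuclideanSpace ℝ (Fin d))),
    Integrable f volume →
      (((T f : LorentzSpace p r hp hr (volume : Measure (EuclideanSpace ℝ (Fin d)))) :
        EuclideanSpace ℝ (Fin d) →ₘ[volume] ℂ) : EuclideanSpace ℝ (Fin d) → ℂ)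
        =ᵐ[volume] fourierIntegralRd f

end

noncomputable section

/-! ### Power integrals, ranks of superlevel sets, and Tonelli identities for truncations. -/

section RealInterpolation

variable {α β : Type*} [MeasurableSpace α] [MeasurableSpace β]

/-! Boundedness is Paley's inequality, obtained by real interpolation with a weight adapted to the
function. For a fixed transform `h`, let φ(x) be the measure of the superlevel set of |h| through x,
so that {φ ≤ s} has measure at most s. With respect to ρ = φ⁻² dν, multiplication by φ is of weak
type from L^∞ to L^{1,∞}, and it maps L² to L² because φ² cancels the density. Splitting f at height
t into an L¹ part and an L² part, whose transforms are controlled by the sup bound and by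
Plancherel, and integrating the two weak type estimates against t^{p-1} gives ∫ (φ|h|)^p dρ ≲
‖f‖_p^p. The left side is ∫ |h|^p φ^{p-2} dν, and since φ ≤ ν{|h| > t} on {|h| > t} and p - 2 < 0,
it dominates the Lorentz integral with exponents p', p. This is
`lorentzIntegral_le_of_decomposition`, applied in `lorentzIntegral_fourier_le`.

The operator itself is defined through L¹ + L²; `HasFourierTransform.unique` makes it independent of
the splitting. Its uniqueness follows from density of integrable functions and convergence in
measure.

The failure of strict singularity comes from a copy of ℓ^p. Take a Schwartz function whose transform
is supported in an annulus, and its L^p-normalized dilates f_n by 4^n. The integrals ∫ |f_n|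
|f_m|^{p-1} decay geometrically in |n - m|, so ‖∑ a_n f_n‖_p^p ≲ ∑ |a_n|^p
(`exists_lintegral_sum_lacunaryDilate_le`). The transforms have disjoint supports at frequency scale
4^n, and the second Lorentz index p is what makes their Lorentz integral at least a constant times ∑
|a_n|^p (`exists_sum_le_lorentzIntegral_fourier`). Together with boundedness, all three quantities
are equivalent on the span of the f_n. -/

theorem lintegral_Ioo_rpow {s a : ℝ} (hs : 0 < s) (ha : 0 ≤ a) :
    ∫⁻ t in Ioo 0 a, ENNReal.ofReal (t ^ (s - 1)) = ENNReal.ofReal (a ^ s / s) := by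
  have hi : IntegrableOn (fun t : ℝ => t ^ (s - 1)) (Ioc 0 a) := by
    have := intervalIntegral.intervalIntegrable_rpow' (a := 0) (b := a)
      (show -1 < s - 1 by linarith)
    rwa [intervalIntegrable_iff_integrableOn_Ioc_of_le ha] at this
  rw [restrict_Ioo_eq_restrict_Ioc, ← ofReal_integral_eq_lintegral_ofReal hi,
    ← intervalIntegral.integral_of_le ha, integral_rpow (Or.inl (by linarith))]
  · simp [Real.zero_rpow hs.ne']
  · filter_upwards [ae_restrict_mem measurableSet_Ioc] with t ht
    exact Real.rpow_nonneg ht.1.le _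

theorem lintegral_Ioi_rpow {s a : ℝ} (hs : 0 < s) (ha : 0 < a) :
    ∫⁻ t in Ioi a, ENNReal.ofReal (t ^ (-s - 1)) = ENNReal.ofReal (a ^ (-s) / s) := by
  rw [← ofReal_integral_eq_lintegral_ofReal (integrableOn_Ioi_rpow_of_lt (by linarith) ha),
    integral_Ioi_rpow_of_lt (by linarith) ha]
  · congr 1
    rw [sub_add_cancel]
    field_simp
  · filter_upwards [ae_restrict_mem measurableSet_Ioi] with t ht
    exact Real.rpow_nonneg (ha.trans ht).le _

/-- The measure of the superlevel set of `H` through the point `x`. -/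
def superlevelRank (ν : Measure β) (H : β → ℝ) (x : β) : ℝ≥0∞ := ν {y | H x ≤ H y}

theorem measurable_superlevelRank (ν : Measure β) {H : β → ℝ} (hH : Measurable H) :
    Measurable (superlevelRank ν H) := by
  have : Antitone fun t : ℝ => ν {y | t ≤ H y} := fun s t hst =>
    measure_mono fun y (hy : t ≤ H y) => hst.trans hy
  exact this.measurable.comp hH

/-- The sublevel set S of the rank is governed by c = inf H over S. If c is attained at a point of
S, then S lies in the superlevel set through that point; otherwise S lies in an increasing union of
such sets, along values of H on S that decrease to c. -/
theorem measure_superlevelRank_le (ν : Measure β) {H : β → ℝ} (h0 : ∀ x, 0 ≤ H x) (s : ℝ≥0∞) :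
    ν {x | superlevelRank ν H x ≤ s} ≤ s := by
  set S := {x | superlevelRank ν H x ≤ s}
  rcases S.eq_empty_or_nonempty with hS | hS
  · simp [hS]
  have hb : BddBelow (H '' S) := ⟨0, by rintro _ ⟨x, -, rfl⟩; exact h0 x⟩
  have hglb := isGLB_csInf (hS.image H) hb
  set c := sInf (H '' S)
  by_cases hc : c ∈ H '' S
  · obtain ⟨x, hx, hxc⟩ := hc
    refine le_trans (measure_mono fun y hy => ?_) hx
    change H x ≤ H y
    rw [hxc]
    exact hglb.1 ⟨y, hy, rfl⟩
  · obtain ⟨u, hu, -, hut, huS⟩ := hglb.exists_seq_antitone_tendsto (hS.image H)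
    have hsub : S ⊆ ⋃ n, {y | u n ≤ H y} := by
      intro y hy
      have hcy : c < H y := lt_of_le_of_ne (hglb.1 ⟨y, hy, rfl⟩) fun h => hc ⟨y, hy, h.symm⟩
      obtain ⟨n, hn⟩ := (hut.eventually (gt_mem_nhds hcy)).exists
      exact mem_iUnion.2 ⟨n, hn.le⟩
    refine (measure_mono hsub).trans ?_
    have hmono : Monotone fun n => {y | u n ≤ H y} := fun m n hmn y (hy : u m ≤ H y) =>
      (hu hmn).trans hy
    rw [hmono.measure_iUnion]
    refine iSup_le fun n => ?_
    obtain ⟨x, hx, hxn⟩ := huS n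
    rw [← hxn]
    exact hx

/-- If the sublevel sets of `φ` have the growth of those of the identity on the half line, then
`φ` is of weak type one for the measure with density `φ⁻²`. -/
theorem withDensity_inv_sq_lt_le {ν : Measure β} {φ : β → ℝ≥0∞} (hφ : Measurable φ)
    (h : ∀ s, ν {x | φ x ≤ s} ≤ s) (u : ℝ≥0∞) :
    ν.withDensity (fun x => (φ x)⁻¹ ^ 2) {x | u < φ x} ≤ 8 / u := by
  rcases eq_or_ne u 0 with rfl | hu0
  · simp [ENNReal.div_zero]
  rcases eq_or_ne u ⊤ with rfl | hut
  · simp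
  have hms : ∀ s, MeasurableSet {x | φ x ≤ s} := fun s => measurableSet_le hφ measurable_const
  rw [withDensity_apply _ (measurableSet_lt measurable_const hφ)]
  -- Dyadic shells: for the first k with φ(x) ≤ 2^k u one has k ≥ 1 and 2^{k-1} u < φ(x), hence the
  -- factor 4. The k-th term integrates to at most 4 / (2^k u), and these sum to 8 / u.
  have hpt : ∀ x ∈ {x | u < φ x}, (φ x)⁻¹ ^ 2 ≤
      ∑' k : ℕ, {x | φ x ≤ 2 ^ k * u}.indicator (fun _ => 4 * (2 ^ k * u)⁻¹ ^ 2) x := by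
    intro x hx
    rcases eq_or_ne (φ x) ⊤ with ht | ht
    · simp [ht]
    have hex : ∃ k : ℕ, φ x ≤ 2 ^ k * u := by
      obtain ⟨n, hn⟩ := ENNReal.exists_nat_mul_gt hu0 ht
      refine ⟨n, hn.le.trans ?_⟩
      gcongr
      exact_mod_cast Nat.lt_two_pow_self.le
    classical
    have hk := Nat.find_spec hex
    refine le_trans ?_ (ENNReal.le_tsum (Nat.find hex))
    rw [indicator_of_mem (show x ∈ {x | φ x ≤ 2 ^ Nat.find hex * u} from hk)]
    obtain ⟨j, hj⟩ : ∃ j, Nat.find hex = j + 1 := by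
      refine Nat.exists_eq_succ_of_ne_zero fun h0 => ?_
      rw [h0, pow_zero, one_mul] at hk
      exact absurd hx (not_lt.2 hk)
    have hlt : 2 ^ j * u < φ x := not_le.1 (Nat.find_min hex (by omega))
    rw [hj]
    have h4 : (4 : ℝ≥0∞) * (2 ^ (j + 1) * u)⁻¹ ^ 2 = (2 ^ j * u)⁻¹ ^ 2 := by
      have : (2 : ℝ≥0∞) ^ (j + 1) * u = 2 * (2 ^ j * u) := by ring
      rw [this, ENNReal.mul_inv (by simp) (by simp), mul_pow, ← mul_assoc]
      have : (4 : ℝ≥0∞) * 2⁻¹ ^ 2 = 1 := by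
        rw [show (4 : ℝ≥0∞) = 2 ^ 2 by norm_num, ← mul_pow, ENNReal.mul_inv_cancel (by simp)
          (by simp), one_pow]
      rw [this, one_mul]
    rw [h4]
    gcongr
  refine (setLIntegral_mono' (measurableSet_lt measurable_const hφ) hpt).trans ?_
  refine (setLIntegral_le_lintegral _ _).trans ?_
  rw [lintegral_tsum fun k => (measurable_const.indicator (hms _)).aemeasurable]
  calc ∑' k : ℕ, ∫⁻ x, {x | φ x ≤ 2 ^ k * u}.indicator (fun _ => 4 * (2 ^ k * u)⁻¹ ^ 2) x ∂ν
      ≤ ∑' k : ℕ, 4 * u⁻¹ * 2⁻¹ ^ k := by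
        refine ENNReal.tsum_le_tsum fun k => ?_
        rw [lintegral_indicator_const (hms _)]
        refine (mul_le_mul_right (h _) _).trans (le_of_eq ?_)
        have h1 : (2 : ℝ≥0∞) ^ k * u ≠ 0 := by simp [hu0]
        have h2 : (2 : ℝ≥0∞) ^ k * u ≠ ⊤ := ENNReal.mul_ne_top (by simp) hut
        rw [sq, mul_assoc, mul_assoc, ENNReal.inv_mul_cancel h1 h2, mul_one,
          ENNReal.mul_inv (by simp) (by simp), ENNReal.inv_pow]
        ring
    _ = 8 / u := by
        rw [ENNReal.tsum_mul_left, ENNReal.tsum_geometric, ENNReal.one_sub_inv_two, inv_inv,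
          ENNReal.div_eq_inv_mul]
        ring

variable {μ : Measure α} {ν : Measure β}

/-- Tonelli: for fixed x the variable t runs over (0, |f(x)|), where t^{p-2} is integrable because p
> 1. -/
theorem lintegral_rpow_mul_setLIntegral_gt [SFinite μ] {f : α → ℂ} (hf : Measurable f) {p : ℝ}
    (hp : 1 < p) :
    ∫⁻ t in Ioi (0 : ℝ), ENNReal.ofReal (t ^ (p - 2)) * ∫⁻ x in {x | t < ‖f x‖}, ‖f x‖ₑ ∂μ =
      ENNReal.ofReal (1 / (p - 1)) * ∫⁻ x, ‖f x‖ₑ ^ p ∂μ := by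
  have hm : MeasurableSet {z : ℝ × α | z.1 < ‖f z.2‖} :=
    measurableSet_lt measurable_fst (hf.norm.comp measurable_snd)
  have hmt : ∀ t : ℝ, MeasurableSet {x | t < ‖f x‖} := fun t =>
    measurableSet_lt measurable_const hf.norm
  calc _ = ∫⁻ t in Ioi (0 : ℝ), ∫⁻ x, {z : ℝ × α | z.1 < ‖f z.2‖}.indicator
          (fun z => ENNReal.ofReal (z.1 ^ (p - 2)) * ‖f z.2‖ₑ) (t, x) ∂μ := by
        refine lintegral_congr fun t => ?_
        rw [← lintegral_const_mul' _ _ ENNReal.ofReal_ne_top, ← lintegral_indicator (hmt t)]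
        rfl
    _ = ∫⁻ x, (∫⁻ t in Ioi (0 : ℝ), {z : ℝ × α | z.1 < ‖f z.2‖}.indicator
          (fun z => ENNReal.ofReal (z.1 ^ (p - 2)) * ‖f z.2‖ₑ) (t, x)) ∂μ := by
        refine lintegral_lintegral_swap ?_
        refine (Measurable.indicator ?_ hm).aemeasurable
        have : Measurable fun z : ℝ × α => f z.2 := hf.comp measurable_snd
        exact Measurable.mul (by fun_prop) this.enorm
    _ = ∫⁻ x, ENNReal.ofReal (1 / (p - 1)) * ‖f x‖ₑ ^ p ∂μ := by
        refine lintegral_congr fun x => ?_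
        have : ∀ t, {z : ℝ × α | z.1 < ‖f z.2‖}.indicator
            (fun z => ENNReal.ofReal (z.1 ^ (p - 2)) * ‖f z.2‖ₑ) (t, x) =
            (Iio ‖f x‖).indicator (fun t => ENNReal.ofReal (t ^ (p - 1 - 1)) * ‖f x‖ₑ) t := by
          intro t
          simp only [indicator_apply, mem_ofPred_eq, mem_Iio]
          ring_nf
        simp_rw [this]
        rw [lintegral_indicator measurableSet_Iio, Measure.restrict_restrict measurableSet_Iio,
          inter_comm, Ioi_inter_Iio, lintegral_mul_const' _ _ enorm_ne_top,
          lintegral_Ioo_rpow (by linarith) (norm_nonneg _), div_eq_mul_one_div, mul_comm (_ ^ _),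
          ENNReal.ofReal_mul (by have := sub_pos.2 hp; positivity), mul_assoc,
          ← ENNReal.ofReal_rpow_of_nonneg (norm_nonneg _) (by linarith), ofReal_norm]
        congr 1
        nth_rw 2 [← ENNReal.rpow_one ‖f x‖ₑ]
        rw [← ENNReal.rpow_add_of_nonneg _ _ (by linarith) zero_le_one]
        ring_nf
    _ = _ := lintegral_const_mul' _ _ ENNReal.ofReal_ne_top

/-- Tonelli again: now t ≥ |f(x)|, and t^{p-3} is integrable at infinity because p < 2. -/
theorem lintegral_rpow_mul_setLIntegral_le [SFinite μ] {f : α → ℂ} (hf : Measurable f) {p : ℝ}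
    (hp0 : 0 < p) (hp : p < 2) :
    ∫⁻ t in Ioi (0 : ℝ), ENNReal.ofReal (t ^ (p - 3)) *
        ∫⁻ x in {x | ‖f x‖ ≤ t}, ‖f x‖ₑ ^ 2 ∂μ =
      ENNReal.ofReal (1 / (2 - p)) * ∫⁻ x, ‖f x‖ₑ ^ p ∂μ := by
  have hm : MeasurableSet {z : ℝ × α | ‖f z.2‖ ≤ z.1} :=
    measurableSet_le (hf.norm.comp measurable_snd) measurable_fst
  have hmt : ∀ t : ℝ, MeasurableSet {x | ‖f x‖ ≤ t} := fun t =>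
    measurableSet_le hf.norm measurable_const
  calc _ = ∫⁻ t in Ioi (0 : ℝ), ∫⁻ x, {z : ℝ × α | ‖f z.2‖ ≤ z.1}.indicator
          (fun z => ENNReal.ofReal (z.1 ^ (p - 3)) * ‖f z.2‖ₑ ^ 2) (t, x) ∂μ := by
        refine lintegral_congr fun t => ?_
        rw [← lintegral_const_mul' _ _ ENNReal.ofReal_ne_top, ← lintegral_indicator (hmt t)]
        rfl
    _ = ∫⁻ x, (∫⁻ t in Ioi (0 : ℝ), {z : ℝ × α | ‖f z.2‖ ≤ z.1}.indicator
          (fun z => ENNReal.ofReal (z.1 ^ (p - 3)) * ‖f z.2‖ₑ ^ 2) (t, x)) ∂μ := by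
        refine lintegral_lintegral_swap ?_
        refine (Measurable.indicator ?_ hm).aemeasurable
        have : Measurable fun z : ℝ × α => f z.2 := hf.comp measurable_snd
        exact Measurable.mul (by fun_prop) (this.enorm.pow_const 2)
    _ = ∫⁻ x, ENNReal.ofReal (1 / (2 - p)) * ‖f x‖ₑ ^ p ∂μ := by
        refine lintegral_congr fun x => ?_
        have : ∀ t, {z : ℝ × α | ‖f z.2‖ ≤ z.1}.indicator
            (fun z => ENNReal.ofReal (z.1 ^ (p - 3)) * ‖f z.2‖ₑ ^ 2) (t, x) =
            (Ici ‖f x‖).indicator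
              (fun t => ENNReal.ofReal (t ^ (-(2 - p) - 1)) * ‖f x‖ₑ ^ 2) t := by
          intro t
          simp only [indicator_apply, mem_ofPred_eq, mem_Ici]
          ring_nf
        simp_rw [this]
        rw [lintegral_indicator measurableSet_Ici, Measure.restrict_restrict measurableSet_Ici,
          lintegral_mul_const' _ _ (by simp)]
        -- At zeros of f the t-integral diverges at 0, but it is multiplied by zero.
        rcases eq_or_ne (f x) 0 with h0 | h0
        · simp [h0, hp0]
        have h0' : 0 < ‖f x‖ := norm_pos_iff.2 h0
        rw [inter_eq_left.2 (show Ici ‖f x‖ ⊆ Ioi 0 from fun t ht => h0'.trans_le ht),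
          ← restrict_Ioi_eq_restrict_Ici,
          lintegral_Ioi_rpow (by linarith) h0', div_eq_mul_one_div, mul_comm (_ ^ _),
          ENNReal.ofReal_mul (by have := sub_pos.2 hp; positivity), mul_assoc,
          ← ENNReal.ofReal_rpow_of_pos h0', ofReal_norm]
        congr 1
        rw [← ENNReal.rpow_natCast, ← ENNReal.rpow_add _ _ (by simpa using h0) enorm_ne_top]
        congr 1
        push_cast
        ring
    _ = _ := lintegral_const_mul' _ _ ENNReal.ofReal_ne_top

end RealInterpolation

/-! ### The interpolation theorem with the rank as weight. -/

section RealInterpolation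

variable {α β : Type*} [MeasurableSpace α] [MeasurableSpace β]
variable {μ : Measure α} {ν : Measure β}

theorem meas_lt_norm_le_lintegral_sq {h : β → ℂ} (hh : AEMeasurable h ν) {t : ℝ} (ht : 0 < t) :
    ν {x | t < ‖h x‖} ≤ (∫⁻ x, ‖h x‖ₑ ^ 2 ∂ν) / ENNReal.ofReal t ^ 2 := by
  have ht' : ENNReal.ofReal t ^ 2 ≠ 0 := by simpa using ht
  refine le_trans (measure_mono fun x (hx : t < ‖h x‖) => ?_)
    (meas_ge_le_lintegral_div (hh.enorm.pow_const 2) ht' (by simp))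
  change ENNReal.ofReal t ^ 2 ≤ ‖h x‖ₑ ^ 2
  gcongr
  rw [← ofReal_norm]
  exact ENNReal.ofReal_le_ofReal hx.le

/-- The weak type estimate for `φ |h|`, from a decomposition of `h` into a bounded and a square
integrable part. -/
theorem withDensity_inv_sq_lt_mul_norm_le {φ : β → ℝ≥0∞} (hφ : Measurable φ)
    (hg : ∀ s, ν {x | φ x ≤ s} ≤ s) {h h₁ h₂ : β → ℂ} (hsum : ∀ᵐ x ∂ν, h x = h₁ x + h₂ x)
    (hm : AEMeasurable h₂ ν) {A B : ℝ≥0∞} (hA : ∀ᵐ x ∂ν, ‖h₁ x‖ₑ ≤ A)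
    (hB : ∫⁻ x, ‖h₂ x‖ₑ ^ 2 ∂ν ≤ B) {t : ℝ} (ht : 0 < t) :
    ν.withDensity (fun x => (φ x)⁻¹ ^ 2) {x | t < (φ x).toReal * ‖h x‖} ≤
      ENNReal.ofReal (16 / t) * A + ENNReal.ofReal (4 / t ^ 2) * B := by
  set ρ := ν.withDensity fun x => (φ x)⁻¹ ^ 2
  have hac : ρ ≪ ν := withDensity_absolutelyContinuous _ _
  set T := ENNReal.ofReal (t / 2)
  have hT0 : T ≠ 0 := by simpa [T] using ht
  have hTt : T ≠ ⊤ := ENNReal.ofReal_ne_top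
  -- One of the two parts must exceed t/2 after multiplication by φ. The bounded part then forces φ
  -- > t/(2A), where the weak type bound for φ applies; the other part is handled by Chebyshev in
  -- L²(ρ).
  have hsplit : ρ {x | t < (φ x).toReal * ‖h x‖} ≤
      ρ {x | T < φ x * A} + ρ {x | T ^ 2 ≤ φ x ^ 2 * ‖h₂ x‖ₑ ^ 2} := by
    refine le_trans (measure_mono_ae ?_) (measure_union_le _ _)
    filter_upwards [hac.ae_le hsum, hac.ae_le hA] with x hx hxA hlt
    change t < (φ x).toReal * ‖h x‖ at hlt
    -- Since `toReal` sends ⊤ to 0, points of infinite rank do not belong to the set.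
    have hφt : φ x ≠ ⊤ := by
      intro h0
      simp only [h0, ENNReal.toReal_top, zero_mul] at hlt
      linarith
    have key : ∀ z : ℂ, t / 2 < (φ x).toReal * ‖z‖ → T < φ x * ‖z‖ₑ := by
      intro z hz
      rw [← ENNReal.ofReal_toReal hφt, ← ofReal_norm, ← ENNReal.ofReal_mul ENNReal.toReal_nonneg]
      exact (ENNReal.ofReal_lt_ofReal_iff ((half_pos ht).trans hz)).2 hz
    by_cases h1 : t / 2 < (φ x).toReal * ‖h₁ x‖
    · left
      exact (key _ h1).trans_le (by gcongr)
    · right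
      have h2 : t / 2 < (φ x).toReal * ‖h₂ x‖ := by
        have := norm_add_le (h₁ x) (h₂ x)
        rw [← hx] at this
        have := mul_le_mul_of_nonneg_left this (ENNReal.toReal_nonneg (a := φ x))
        rw [mul_add] at this
        linarith [not_lt.1 h1]
      change T ^ 2 ≤ φ x ^ 2 * ‖h₂ x‖ₑ ^ 2
      rw [← mul_pow]
      exact pow_le_pow_left' (key _ h2).le 2
  refine hsplit.trans (add_le_add ?_ ?_)
  · rcases eq_or_ne A 0 with rfl | hA0
    · simp
    rcases eq_or_ne A ⊤ with rfl | hAt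
    · rw [ENNReal.mul_top (by simpa using ht)]
      exact le_top
    calc ρ {x | T < φ x * A} ≤ ρ {x | T / A < φ x} :=
          measure_mono fun x hx => ENNReal.div_lt_of_lt_mul hx
      _ ≤ 8 / (T / A) := withDensity_inv_sq_lt_le hφ hg _
      _ = ENNReal.ofReal (16 / t) * A := by
          rw [ENNReal.div_eq_inv_mul, ENNReal.inv_div (Or.inl hAt) (Or.inl hA0),
            show (16 : ℝ) / t = 8 / (t / 2) by ring, ENNReal.ofReal_div_of_pos (half_pos ht)]
          simp only [ENNReal.div_eq_inv_mul, T]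
          norm_num
          ring
  · refine (meas_ge_le_lintegral_div ?_ (by simpa using hT0) (by simp [hTt])).trans ?_
    · exact (hφ.pow_const 2).aemeasurable.mul
        ((hm.mono_ac hac).enorm.pow_const 2)
    have : ∫⁻ x, φ x ^ 2 * ‖h₂ x‖ₑ ^ 2 ∂ρ ≤ B := by
      have hd : AEMeasurable (fun x => (φ x)⁻¹ ^ 2) ν := by fun_prop
      rw [lintegral_withDensity_eq_lintegral_mul₀ hd (g := fun x => φ x ^ 2 * ‖h₂ x‖ₑ ^ 2)
        ((hφ.pow_const 2).aemeasurable.mul (hm.enorm.pow_const 2))]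
      refine le_trans (lintegral_mono fun x => ?_) hB
      change (φ x)⁻¹ ^ 2 * (φ x ^ 2 * ‖h₂ x‖ₑ ^ 2) ≤ ‖h₂ x‖ₑ ^ 2
      rw [← mul_assoc, ← mul_pow]
      exact mul_le_of_le_one_left' (pow_le_one' (ENNReal.inv_mul_le_one _) 2)
    refine (ENNReal.div_le_div_right this _).trans (le_of_eq ?_)
    rw [show (4 : ℝ) / t ^ 2 = ((t / 2) ^ 2)⁻¹ by field_simp; norm_num,
      ENNReal.ofReal_inv_of_pos (by positivity), ENNReal.ofReal_pow (by positivity),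
      ENNReal.div_eq_inv_mul]

/-- The integral over the region `{t < H}` of a negative power of the superlevel rank dominates the
distribution function. -/
theorem rpow_meas_le_setLIntegral_superlevelRank {H : β → ℝ} (hH : Measurable H) {p : ℝ}
    (hp1 : 1 < p) (hp2 : p < 2) {t : ℝ} (hfin : ν {x | t < H x} ≠ ⊤) :
    ν {x | t < H x} ^ (p - 1) ≤
      ν.withDensity (fun x => superlevelRank ν H x ^ (p - 2)) {x | t < H x} := by
  have hms : MeasurableSet {x | t < H x} := measurableSet_lt measurable_const hH
  rw [withDensity_apply _ hms]
  rcases eq_or_ne (ν {x | t < H x}) 0 with h0 | h0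
  · rw [h0, ENNReal.zero_rpow_of_pos (by linarith)]
    exact zero_le
  calc ν {x | t < H x} ^ (p - 1) = ∫⁻ _ in {x | t < H x}, ν {x | t < H x} ^ (p - 2) ∂ν := by
        rw [setLIntegral_const]
        nth_rw 3 [← ENNReal.rpow_one (ν {x | t < H x})]
        rw [← ENNReal.rpow_add _ _ h0 hfin]
        ring_nf
    _ ≤ _ := by
        refine setLIntegral_mono' hms fun x hx => ?_
        have hle : superlevelRank ν H x ≤ ν {x | t < H x} := measure_mono fun y hy =>
          lt_of_lt_of_le (show t < H x from hx) hy
        rw [← neg_sub, ENNReal.rpow_neg, ENNReal.rpow_neg, ENNReal.inv_le_inv]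
        exact ENNReal.rpow_le_rpow hle (by linarith)

/-- Where |f| > s, |f| ≤ s^{1-p} |f|^p. This gives integrability of the large part of an L^p
function, and decay of its L¹ norm as s → ∞. -/
theorem setLIntegral_gt_le_mul_lintegral_rpow {f : α → ℂ} (hf : Measurable f) {p : ℝ} (hp1 : 1 < p)
    {s : ℝ} (hs0 : 0 < s) :
    ∫⁻ y in {y | s < ‖f y‖}, ‖f y‖ₑ ∂μ ≤
      ENNReal.ofReal (s ^ (-(p - 1))) * ∫⁻ x, ‖f x‖ₑ ^ p ∂μ := by
  have hmt : MeasurableSet {x | s < ‖f x‖} := measurableSet_lt measurable_const hf.norm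
  rw [← lintegral_const_mul' _ _ ENNReal.ofReal_ne_top]
  refine (setLIntegral_mono' hmt fun x hx => ?_).trans (setLIntegral_le_lintegral _ _)
  have hx' : 0 < ‖f x‖ := hs0.trans hx
  rw [← ofReal_norm, ENNReal.ofReal_rpow_of_pos hx', ← ENNReal.ofReal_mul (by positivity)]
  refine ENNReal.ofReal_le_ofReal ?_
  rw [Real.rpow_neg hs0.le, le_inv_mul_iff₀ (by positivity)]
  calc s ^ (p - 1) * ‖f x‖ ≤ ‖f x‖ ^ (p - 1) * ‖f x‖ := by
        gcongr
        · exact le_of_lt hx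
    _ = ‖f x‖ ^ p := by
        rw [← Real.rpow_add_one hx'.ne', sub_add_cancel]

theorem setLIntegral_sq_le_le_mul_lintegral_rpow {f : α → ℂ} (hf : Measurable f) {p : ℝ}
    (hp1 : 1 ≤ p) (hp2 : p < 2) {s : ℝ} (hs : 0 < s) :
    ∫⁻ y in {y | ‖f y‖ ≤ s}, ‖f y‖ₑ ^ 2 ∂μ ≤
      ENNReal.ofReal (s ^ (2 - p)) * ∫⁻ x, ‖f x‖ₑ ^ p ∂μ := by
  have hmt' : MeasurableSet {x | ‖f x‖ ≤ s} := measurableSet_le hf.norm measurable_const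
  rw [← lintegral_const_mul' _ _ ENNReal.ofReal_ne_top]
  refine (setLIntegral_mono' hmt' fun x hx => ?_).trans (setLIntegral_le_lintegral _ _)
  rw [← ofReal_norm, ENNReal.ofReal_rpow_of_nonneg (norm_nonneg _) (by linarith),
    ← ENNReal.ofReal_pow (norm_nonneg _), ← ENNReal.ofReal_mul (by positivity)]
  refine ENNReal.ofReal_le_ofReal ?_
  calc ‖f x‖ ^ 2 = ‖f x‖ ^ (2 - p) * ‖f x‖ ^ p := by
        rw [← Real.rpow_add_of_nonneg (norm_nonneg _) (by linarith) (by linarith),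
          sub_add_cancel, Real.rpow_two]
    _ ≤ s ^ (2 - p) * ‖f x‖ ^ p := by
        refine mul_le_mul_of_nonneg_right ?_ (by positivity)
        exact Real.rpow_le_rpow (norm_nonneg _) hx (by linarith)

/-- A real interpolation theorem. If for every level `s` the function `h` is the sum of a function
bounded by the integral of `|f|` over `{|f| > s}` and a function whose square has integral
controlled by that of `|f|²` over `{|f| ≤ s}`, then the `L^{p',p}` functional of `h` is controlled
by the `L^p` norm of `f`. -/
theorem lorentzIntegral_le_of_decomposition [SFinite μ] {p p' : ℝ} (hp1 : 1 < p) (hp2 : p < 2)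
    (hpp' : p.HolderConjugate p') {f : α → ℂ} (hf : Measurable f)
    (hfp : ∫⁻ x, ‖f x‖ₑ ^ p ∂μ ≠ ⊤) {h : β → ℂ} (hh : Measurable h) {K : ℝ≥0∞} (hK : K ≠ ⊤)
    (hdec : ∀ s : ℝ, 0 < s → ∃ h₁ h₂ : β → ℂ, AEMeasurable h₂ ν ∧
      (∀ᵐ x ∂ν, h x = h₁ x + h₂ x) ∧
      (∀ᵐ x ∂ν, ‖h₁ x‖ₑ ≤ ∫⁻ y in {y | s < ‖f y‖}, ‖f y‖ₑ ∂μ) ∧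
      ∫⁻ x, ‖h₂ x‖ₑ ^ 2 ∂ν ≤ K * ∫⁻ y in {y | ‖f y‖ ≤ s}, ‖f y‖ₑ ^ 2 ∂μ) :
    lorentzIntegral p' p ν h ≤
      (ENNReal.ofReal (16 / (p - 1)) + ENNReal.ofReal (4 / (2 - p)) * K) *
        ∫⁻ x, ‖f x‖ₑ ^ p ∂μ := by
  set H : β → ℝ := fun x => ‖h x‖
  have hH : Measurable H := hh.norm
  set φ := superlevelRank ν H
  have hφ : Measurable φ := measurable_superlevelRank ν hH
  have hφs : ∀ s, ν {x | φ x ≤ s} ≤ s := measure_superlevelRank_le ν fun x => norm_nonneg _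
  have hmt : ∀ t : ℝ, MeasurableSet {x | t < ‖f x‖} := fun t =>
    measurableSet_lt measurable_const hf.norm
  have hmt' : ∀ t : ℝ, MeasurableSet {x | ‖f x‖ ≤ t} := fun t =>
    measurableSet_le hf.norm measurable_const
  -- Finiteness of the distribution function is needed to combine its powers 1 and p - 2. A large
  -- splitting level s makes the bounded part at most t/2, so only the L² part can push |h| above t.
  have hfin : ∀ t : ℝ, 0 < t → ν {x | t < H x} ≠ ⊤ := by
    intro t ht
    obtain ⟨s, hs, hsA⟩ : ∃ s : ℝ, 0 < s ∧
        ∫⁻ y in {y | s < ‖f y‖}, ‖f y‖ₑ ∂μ ≤ ENNReal.ofReal (t / 2) := by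
      have htend : Filter.Tendsto (fun s : ℝ => ENNReal.ofReal (s ^ (-(p - 1))) *
          ∫⁻ x, ‖f x‖ₑ ^ p ∂μ) Filter.atTop (nhds 0) := by
        have h1 := ENNReal.tendsto_ofReal (tendsto_rpow_neg_atTop (sub_pos.2 hp1))
        have h2 := ENNReal.Tendsto.mul_const h1 (Or.inr hfp)
        simpa using h2
      have hev := htend.eventually (ge_mem_nhds (show 0 < ENNReal.ofReal (t / 2) by simpa using ht))
      obtain ⟨s, hs, hs0⟩ := (hev.and (Filter.eventually_gt_atTop 0)).exists
      exact ⟨s, hs0, (setLIntegral_gt_le_mul_lintegral_rpow hf hp1 hs0).trans hs⟩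
    obtain ⟨h₁, h₂, hm, hsum, hA, hB⟩ := hdec s hs
    have hB' : ∫⁻ y in {y | ‖f y‖ ≤ s}, ‖f y‖ₑ ^ 2 ∂μ < ⊤ :=
      (setLIntegral_sq_le_le_mul_lintegral_rpow hf hp1.le hp2 hs).trans_lt
        (ENNReal.mul_lt_top ENNReal.ofReal_lt_top hfp.lt_top)
    have hle : ν {x | t < H x} ≤ ν {x | t / 2 < ‖h₂ x‖} := by
      refine measure_mono_ae ?_
      filter_upwards [hsum, hA] with x hx hxA hlt
      change t < ‖h x‖ at hlt
      change t / 2 < ‖h₂ x‖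
      have h1 : ‖h₁ x‖ ≤ t / 2 := by
        have := hxA.trans hsA
        rwa [← ofReal_norm, ENNReal.ofReal_le_ofReal_iff (by positivity)] at this
      have := norm_add_le (h₁ x) (h₂ x)
      rw [← hx] at this
      linarith
    refine ((hle.trans (meas_lt_norm_le_lintegral_sq hm (half_pos ht))).trans_lt ?_).ne
    refine ENNReal.div_lt_top (hB.trans_lt (ENNReal.mul_lt_top hK.lt_top hB')).ne ?_
    simpa using ht
  set ρ := ν.withDensity fun x => (φ x)⁻¹ ^ 2
  set ρ' := ν.withDensity fun x => φ x ^ (p - 2)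
  have hp0 : 0 < p := by linarith
  have hpq : p / p' = p - 1 := by
    rw [div_eq_mul_inv, ← hpp'.one_sub_inv]
    field_simp
  -- Layer cake for H^p with respect to φ^{p-2} dν, whose mass on {t < H} dominates ν{t < H}^{p-1};
  -- here p - 1 is the Lorentz exponent p/p'.
  have hlow : ENNReal.ofReal p * lorentzIntegral p' p ν h ≤ ∫⁻ x, ENNReal.ofReal (H x ^ p) ∂ρ' := by
    rw [lintegral_rpow_eq_lintegral_meas_lt_mul ρ' (.of_forall fun x => norm_nonneg _)
      hH.aemeasurable hp0]
    gcongr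
    unfold lorentzIntegral
    rw [hpq]
    refine setLIntegral_mono' measurableSet_Ioi fun t ht => ?_
    rw [mul_comm]
    gcongr
    exact rpow_meas_le_setLIntegral_superlevelRank hH hp1 hp2 (hfin t ht)
  -- Pointwise H^p φ^{p-2} = (φH)^p φ⁻² where 0 < φ < ∞. The set φ = 0 is null, and where φ = ∞ the
  -- left side vanishes as p < 2.
  have hmid : ∫⁻ x, ENNReal.ofReal (H x ^ p) ∂ρ' ≤
      ∫⁻ x, ENNReal.ofReal (((φ x).toReal * H x) ^ p) ∂ρ := by
    rw [lintegral_withDensity_eq_lintegral_mul _ (by fun_prop) (by fun_prop),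
      lintegral_withDensity_eq_lintegral_mul _ (by fun_prop) (by fun_prop)]
    have hpos : ∀ᵐ x ∂ν, φ x ≠ 0 := by
      rw [ae_iff]
      simpa using hφs 0
    refine lintegral_mono_ae ?_
    filter_upwards [hpos] with x hx
    change φ x ^ (p - 2) * ENNReal.ofReal (H x ^ p) ≤
      (φ x)⁻¹ ^ 2 * ENNReal.ofReal (((φ x).toReal * H x) ^ p)
    rcases eq_or_ne (φ x) ⊤ with ht | ht
    · rw [ht, ENNReal.top_rpow_of_neg (by linarith), zero_mul]
      exact zero_le
    rw [Real.mul_rpow ENNReal.toReal_nonneg (norm_nonneg _), ENNReal.ofReal_mul (by positivity),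
      ← ENNReal.ofReal_rpow_of_nonneg ENNReal.toReal_nonneg hp0.le, ENNReal.ofReal_toReal ht,
      ← mul_assoc, ← ENNReal.inv_pow, ← ENNReal.rpow_natCast, ← ENNReal.rpow_neg,
      ← ENNReal.rpow_add _ _ hx ht]
    refine le_of_eq ?_
    congr 2
    push_cast
    ring
  have hhigh : ∫⁻ x, ENNReal.ofReal (((φ x).toReal * H x) ^ p) ∂ρ ≤ ENNReal.ofReal p *
      ((ENNReal.ofReal (16 / (p - 1)) + ENNReal.ofReal (4 / (2 - p)) * K) *
        ∫⁻ x, ‖f x‖ₑ ^ p ∂μ) := by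
    rw [lintegral_rpow_eq_lintegral_meas_lt_mul ρ
      (.of_forall fun x => mul_nonneg ENNReal.toReal_nonneg (norm_nonneg _))
      (by fun_prop) hp0]
    gcongr
    calc _ ≤ ∫⁻ t in Ioi (0 : ℝ), (16 * (ENNReal.ofReal (t ^ (p - 2)) *
            ∫⁻ x in {x | t < ‖f x‖}, ‖f x‖ₑ ∂μ) + 4 * K * (ENNReal.ofReal (t ^ (p - 3)) *
            ∫⁻ x in {x | ‖f x‖ ≤ t}, ‖f x‖ₑ ^ 2 ∂μ)) := by
          refine setLIntegral_mono' measurableSet_Ioi fun t (ht : 0 < t) => ?_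
          -- The splitting level of f is the layer cake level t itself.
          obtain ⟨h₁, h₂, hm, hsum, hA, hB⟩ := hdec t ht
          refine (mul_le_mul_left
            (withDensity_inv_sq_lt_mul_norm_le hφ hφs hsum hm hA hB ht) _).trans (le_of_eq ?_)
          have e1 : ENNReal.ofReal (16 / t) * ENNReal.ofReal (t ^ (p - 1)) =
              16 * ENNReal.ofReal (t ^ (p - 2)) := by
            rw [← ENNReal.ofReal_mul (by positivity), show (16 : ℝ≥0∞) = ENNReal.ofReal 16 by simp,
              ← ENNReal.ofReal_mul (by positivity)]
            congr 1
            rw [show p - 1 = p - 2 + 1 by ring, Real.rpow_add_one ht.ne']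
            field_simp
          have e2 : ENNReal.ofReal (4 / t ^ 2) * ENNReal.ofReal (t ^ (p - 1)) =
              4 * ENNReal.ofReal (t ^ (p - 3)) := by
            rw [← ENNReal.ofReal_mul (by positivity), show (4 : ℝ≥0∞) = ENNReal.ofReal 4 by simp,
              ← ENNReal.ofReal_mul (by positivity)]
            congr 1
            rw [show p - 1 = p - 3 + 2 by ring, Real.rpow_add ht, Real.rpow_two]
            field_simp
          rw [add_mul, mul_right_comm, e1, mul_right_comm (ENNReal.ofReal (4 / t ^ 2)), e2]
          ring
      _ = _ := by
          have hanti : Measurable fun t : ℝ => ∫⁻ x in {x | t < ‖f x‖}, ‖f x‖ₑ ∂μ := by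
            refine Antitone.measurable fun s t hst => ?_
            exact lintegral_mono_set fun x (hx : t < ‖f x‖) => hst.trans_lt hx
          rw [lintegral_add_left (by fun_prop), lintegral_const_mul' _ _ (by simp),
            lintegral_const_mul' _ _ (ENNReal.mul_ne_top (by simp) hK),
            lintegral_rpow_mul_setLIntegral_gt hf hp1, lintegral_rpow_mul_setLIntegral_le hf hp0 hp2,
            div_eq_mul_one_div 16, div_eq_mul_one_div 4, ENNReal.ofReal_mul (by positivity),
            ENNReal.ofReal_mul (by positivity)]
          simp only [ENNReal.ofReal_ofNat]
          ring
  have := (hlow.trans hmid).trans hhigh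
  rwa [ENNReal.mul_le_mul_iff_right (by simpa using hp0) ENNReal.ofReal_ne_top] at this

end RealInterpolation

/-! ### The Fourier transform on L¹ + L². -/

section FourierExtension

open scoped FourierTransform SchwartzMap ContDiff

variable {d : ℕ}

/-- Passing from the kernel e^{-2πi⟨x,t⟩} to e^{-i⟨x,t⟩} rescales the frequency by 1/(2π); this is
the source of the factor (2π)^d in the Plancherel identity below. -/
theorem fourierIntegralRd_eq_fourier (f : EuclideanSpace ℝ (Fin d) → ℂ)
    (x : EuclideanSpace ℝ (Fin d)) : fourierIntegralRd f x = 𝓕 f ((2 * Real.pi)⁻¹ • x) := by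
  rw [fourierIntegralRd, Real.fourier_eq']
  refine integral_congr_ae (.of_forall fun t => ?_)
  simp only [smul_eq_mul, inner_smul_right, real_inner_comm x t]
  rw [mul_comm]
  congr 2
  push_cast
  have : (Real.pi : ℂ) ≠ 0 := by exact_mod_cast Real.pi_ne_zero
  field_simp

theorem lintegral_comp_smul_euclidean {r : ℝ} (hr : r ≠ 0)
    (g : EuclideanSpace ℝ (Fin d) → ℝ≥0∞) :
    ∫⁻ x, g (r • x) = ENNReal.ofReal |(r ^ d)⁻¹| * ∫⁻ x, g x := by
  have h := lintegral_map_equiv (μ := (volume : Measure (EuclideanSpace ℝ (Fin d)))) g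
    (Homeomorph.smulOfNeZero r hr).toMeasurableEquiv
  have h2 := Measure.map_addHaar_smul (volume : Measure (EuclideanSpace ℝ (Fin d))) hr
  rw [finrank_euclideanSpace_fin] at h2
  change ∫⁻ a, g a ∂(Measure.map (r • ·) volume) = ∫⁻ a, g (r • a) at h
  rw [← h, h2, lintegral_smul_measure, smul_eq_mul]

theorem quasiMeasurePreserving_smul_euclidean {r : ℝ} (hr : r ≠ 0) :
    Measure.QuasiMeasurePreserving (fun x : EuclideanSpace ℝ (Fin d) => r • x) volume volume := by
  refine ⟨measurable_const_smul r, ?_⟩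
  rw [Measure.map_addHaar_smul _ hr]
  exact Measure.smul_absolutelyContinuous

theorem enorm_fourierIntegralRd_le (f : EuclideanSpace ℝ (Fin d) → ℂ)
    (x : EuclideanSpace ℝ (Fin d)) : ‖fourierIntegralRd f x‖ₑ ≤ ∫⁻ t, ‖f t‖ₑ := by
  refine (enorm_integral_le_lintegral_enorm _).trans (lintegral_mono fun t => le_of_eq ?_)
  rw [enorm_mul]
  have : ‖Complex.exp (-Complex.I * ((inner ℝ x t : ℝ) : ℂ))‖ = 1 := by
    rw [show -Complex.I * ((inner ℝ x t : ℝ) : ℂ) = ((-(inner ℝ x t) : ℝ) : ℂ) * Complex.I by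
      push_cast; ring, Complex.norm_exp_ofReal_mul_I]
  rw [← ofReal_norm (Complex.exp _), this, ENNReal.ofReal_one, mul_one]

theorem fourierIntegralRd_congr_ae {f g : EuclideanSpace ℝ (Fin d) → ℂ} (h : f =ᵐ[volume] g) :
    fourierIntegralRd f = fourierIntegralRd g := by
  ext x
  rw [fourierIntegralRd_eq_fourier, fourierIntegralRd_eq_fourier, Real.fourier_congr_ae h]

theorem integrable_mul_exp_inner {f : EuclideanSpace ℝ (Fin d) → ℂ} (hf : Integrable f)
    (x : EuclideanSpace ℝ (Fin d)) :
    Integrable fun t => f t * Complex.exp (-Complex.I * ((inner ℝ x t : ℝ) : ℂ)) := by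
  refine hf.mul_bdd (c := 1) (Continuous.aestronglyMeasurable (by fun_prop))
    (.of_forall fun t => ?_)
  rw [show -Complex.I * ((inner ℝ x t : ℝ) : ℂ) = ((-(inner ℝ x t) : ℝ) : ℂ) * Complex.I by
      push_cast; ring, Complex.norm_exp_ofReal_mul_I]

theorem fourierIntegralRd_add {f g : EuclideanSpace ℝ (Fin d) → ℂ} (hf : Integrable f)
    (hg : Integrable g) :
    fourierIntegralRd (f + g) = fourierIntegralRd f + fourierIntegralRd g := by
  ext x
  simp only [fourierIntegralRd, Pi.add_apply, add_mul]
  exact integral_add (integrable_mul_exp_inner hf x) (integrable_mul_exp_inner hg x)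

theorem fourierIntegralRd_smul (c : ℂ) (f : EuclideanSpace ℝ (Fin d) → ℂ) :
    fourierIntegralRd (c • f) = c • fourierIntegralRd f := by
  ext x
  simp only [fourierIntegralRd, Pi.smul_apply, smul_eq_mul, mul_assoc]
  exact integral_const_mul _ _

/-- The Fourier transform of a square integrable function, in the normalization of
`fourierIntegralRd`. -/
def fourierL2Rd (v : Lp ℂ 2 (volume : Measure (EuclideanSpace ℝ (Fin d))))
    (x : EuclideanSpace ℝ (Fin d)) : ℂ :=
  (𝓕 v : Lp ℂ 2 (volume : Measure (EuclideanSpace ℝ (Fin d)))) ((2 * Real.pi)⁻¹ • x)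

theorem inv_two_pi_ne_zero : (2 * Real.pi)⁻¹ ≠ 0 := inv_ne_zero Real.two_pi_pos.ne'

theorem aestronglyMeasurable_fourierL2Rd
    (v : Lp ℂ 2 (volume : Measure (EuclideanSpace ℝ (Fin d)))) :
    AEStronglyMeasurable (fourierL2Rd v) volume :=
  (Lp.aestronglyMeasurable _).comp_quasiMeasurePreserving
    (quasiMeasurePreserving_smul_euclidean inv_two_pi_ne_zero)

theorem fourierL2Rd_add (v w : Lp ℂ 2 (volume : Measure (EuclideanSpace ℝ (Fin d)))) :
    fourierL2Rd (v + w) =ᵐ[volume] fourierL2Rd v + fourierL2Rd w := by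
  have h := Lp.coeFn_add (𝓕 v : Lp ℂ 2 (volume : Measure (EuclideanSpace ℝ (Fin d)))) (𝓕 w)
  rw [← FourierTransform.fourier_add] at h
  exact (quasiMeasurePreserving_smul_euclidean inv_two_pi_ne_zero).ae_eq_comp h

theorem fourierL2Rd_smul (c : ℂ) (v : Lp ℂ 2 (volume : Measure (EuclideanSpace ℝ (Fin d)))) :
    fourierL2Rd (c • v) =ᵐ[volume] c • fourierL2Rd v := by
  have h := Lp.coeFn_smul c (𝓕 v : Lp ℂ 2 (volume : Measure (EuclideanSpace ℝ (Fin d))))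
  rw [← FourierTransform.fourier_smul] at h
  exact (quasiMeasurePreserving_smul_euclidean inv_two_pi_ne_zero).ae_eq_comp h

theorem lintegral_enorm_sq_eq_enorm_Lp (v : Lp ℂ 2 (volume : Measure (EuclideanSpace ℝ (Fin d)))) :
    ∫⁻ x, ‖v x‖ₑ ^ 2 = ‖v‖ₑ ^ 2 := by
  rw [Lp.enorm_def, eLpNorm_eq_lintegral_rpow_enorm_toReal (by simp) (by simp)]
  simp only [ENNReal.toReal_ofNat, ENNReal.rpow_ofNat]
  rw [← ENNReal.rpow_natCast, ← ENNReal.rpow_mul]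
  simp

theorem lintegral_enorm_fourierL2Rd_sq
    (v : Lp ℂ 2 (volume : Measure (EuclideanSpace ℝ (Fin d)))) :
    ∫⁻ x, ‖fourierL2Rd v x‖ₑ ^ 2 = ENNReal.ofReal ((2 * Real.pi) ^ d) * ∫⁻ x, ‖v x‖ₑ ^ 2 := by
  have h := lintegral_comp_smul_euclidean (d := d) inv_two_pi_ne_zero fun x =>
    ‖(𝓕 v : Lp ℂ 2 (volume : Measure (EuclideanSpace ℝ (Fin d)))) x‖ₑ ^ 2
  refine h.trans ?_
  rw [lintegral_enorm_sq_eq_enorm_Lp, lintegral_enorm_sq_eq_enorm_Lp, ← ofReal_norm,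
    Lp.norm_fourier_eq, ofReal_norm, inv_pow, inv_inv, abs_of_pos (by positivity)]

/-- The Fourier integral and the `L²` Fourier transform agree on `L¹ ∩ L²`. -/
theorem fourier_ae_eq_fourier_Lp_two {u : EuclideanSpace ℝ (Fin d) → ℂ} (hu : Integrable u)
    (v : Lp ℂ 2 (volume : Measure (EuclideanSpace ℝ (Fin d)))) (huv : u =ᵐ[volume] v) :
    𝓕 u =ᵐ[volume] (𝓕 v : Lp ℂ 2 (volume : Measure (EuclideanSpace ℝ (Fin d)))) := by
  have hcont : Continuous (𝓕 u) := by
    refine VectorFourier.fourierIntegral_continuous Real.continuous_fourierChar ?_ hu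
    exact continuous_inner
  refine ae_eq_of_integral_contDiff_smul_eq hcont.locallyIntegrable
    ((Lp.memLp _).locallyIntegrable one_le_two) fun g hg hgc => ?_
  let φ : 𝓢(EuclideanSpace ℝ (Fin d), ℂ) :=
    (show HasCompactSupport (fun x => (g x : ℂ)) from hgc.comp_left Complex.ofReal_zero).toSchwartzMap
      (Complex.ofRealCLM.contDiff.comp hg)
  have hφ : ∀ x, φ x = g x := fun x => rfl
  -- Both transforms are tested against a smooth compactly supported g. On the L² side the
  -- multiplication formula is the definition of the transform of a tempered distribution; on the L¹
  -- side it is Fubini (`h2`).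
  have h1 : ∫ x, g x • (𝓕 v : Lp ℂ 2 (volume : Measure (EuclideanSpace ℝ (Fin d)))) x =
      ∫ x, (𝓕 φ) x • v x := by
    have := congrArg (fun D => D φ) (Lp.fourier_toTemperedDistribution_eq v)
    simp only [TemperedDistribution.fourier_apply, Lp.toTemperedDistribution_apply, hφ] at this
    rw [this]
    rfl
  rw [h1]
  have h2 := VectorFourier.integral_fourierIntegral_smul_eq_flip (e := Real.fourierChar)
    (L := innerₗ (EuclideanSpace ℝ (Fin d))) (μ := volume) (ν := volume) (f := u)
    (g := (φ : EuclideanSpace ℝ (Fin d) → ℂ)) Real.continuous_fourierChar continuous_inner hu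
    φ.integrable
  rw [flip_innerₗ] at h2
  calc ∫ x, g x • 𝓕 u x = ∫ x, 𝓕 u x • φ x := by
        refine integral_congr_ae (.of_forall fun x => ?_)
        simp [hφ, mul_comm]
    _ = ∫ x, u x • 𝓕 (φ : EuclideanSpace ℝ (Fin d) → ℂ) x := h2
    _ = _ := by
        refine integral_congr_ae ?_
        filter_upwards [huv] with x hx
        rw [hx, SchwartzMap.fourier_coe, smul_eq_mul, smul_eq_mul, mul_comm]

theorem fourierIntegralRd_ae_eq_fourierL2Rd {u : EuclideanSpace ℝ (Fin d) → ℂ} (hu : Integrable u)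
    (v : Lp ℂ 2 (volume : Measure (EuclideanSpace ℝ (Fin d)))) (huv : u =ᵐ[volume] v) :
    fourierIntegralRd u =ᵐ[volume] fourierL2Rd v := by
  have h := (quasiMeasurePreserving_smul_euclidean inv_two_pi_ne_zero).ae_eq_comp
    (fourier_ae_eq_fourier_Lp_two hu v huv)
  filter_upwards [h] with x hx
  rw [fourierIntegralRd_eq_fourier]
  exact hx

/-- `h` is the Fourier transform of `f ∈ L¹ + L²`. -/
def HasFourierTransform (f h : EuclideanSpace ℝ (Fin d) → ℂ) : Prop :=
  ∃ (u : EuclideanSpace ℝ (Fin d) → ℂ)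
    (v : Lp ℂ 2 (volume : Measure (EuclideanSpace ℝ (Fin d)))), Integrable u ∧
    f =ᵐ[volume] u + v ∧ h =ᵐ[volume] fourierIntegralRd u + fourierL2Rd v

namespace HasFourierTransform

variable {f g h k : EuclideanSpace ℝ (Fin d) → ℂ}

theorem add (hf : HasFourierTransform f h) (hg : HasFourierTransform g k) :
    HasFourierTransform (f + g) (h + k) := by
  obtain ⟨u, v, hu, hfu, hh⟩ := hf
  obtain ⟨u', v', hu', hgu, hk⟩ := hg
  refine ⟨u + u', v + v', hu.add hu', ?_, ?_⟩
  · filter_upwards [hfu, hgu, Lp.coeFn_add v v'] with x h1 h2 h3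
    simp only [Pi.add_apply] at *
    rw [h1, h2, h3]
    ring
  · rw [fourierIntegralRd_add hu hu']
    filter_upwards [hh, hk, fourierL2Rd_add v v'] with x h1 h2 h3
    simp only [Pi.add_apply] at *
    rw [h1, h2, h3]
    ring

theorem smul (c : ℂ) (hf : HasFourierTransform f h) : HasFourierTransform (c • f) (c • h) := by
  obtain ⟨u, v, hu, hfu, hh⟩ := hf
  refine ⟨c • u, c • v, hu.smul c, ?_, ?_⟩
  · filter_upwards [hfu, Lp.coeFn_smul c v] with x h1 h3
    simp only [Pi.add_apply, Pi.smul_apply, smul_eq_mul] at *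
    rw [h1, h3]
    ring
  · rw [fourierIntegralRd_smul]
    filter_upwards [hh, fourierL2Rd_smul c v] with x h1 h3
    simp only [Pi.add_apply, Pi.smul_apply, smul_eq_mul] at *
    rw [h1, h3]
    ring

theorem congr (hf : HasFourierTransform f h) (hfg : f =ᵐ[volume] g) (hhk : h =ᵐ[volume] k) :
    HasFourierTransform g k := by
  obtain ⟨u, v, hu, hfu, hh⟩ := hf
  exact ⟨u, v, hu, hfg.symm.trans hfu, hhk.symm.trans hh⟩

theorem of_add {u : EuclideanSpace ℝ (Fin d) → ℂ} (hu : Integrable u)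
    (v : Lp ℂ 2 (volume : Measure (EuclideanSpace ℝ (Fin d)))) :
    HasFourierTransform (u + (v : EuclideanSpace ℝ (Fin d) → ℂ)) (fourierIntegralRd u + fourierL2Rd v) :=
  ⟨u, v, hu, .rfl, .rfl⟩

/-- If u + v = 0 then u = -v lies in L¹ ∩ L², where the two transforms agree, so their contributions
cancel. By linearity the transform does not depend on the splitting. -/
theorem ae_eq_zero (hh : HasFourierTransform 0 h) : h =ᵐ[volume] 0 := by
  obtain ⟨u, v, hu, hfu, hh⟩ := hh
  have huv : u =ᵐ[volume] ((-1 : ℂ) • v : Lp ℂ 2 (volume : Measure (EuclideanSpace ℝ (Fin d)))) := by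
    filter_upwards [hfu, Lp.coeFn_smul (-1 : ℂ) v] with x h1 h2
    simp only [Pi.add_apply, Pi.zero_apply, Pi.smul_apply, smul_eq_mul] at *
    rw [h2]
    linear_combination -h1
  filter_upwards [hh, fourierIntegralRd_ae_eq_fourierL2Rd hu _ huv, fourierL2Rd_smul (-1) v]
    with x h1 h2 h3
  simp only [Pi.add_apply, Pi.zero_apply, Pi.smul_apply, smul_eq_mul] at *
  rw [h1, h2, h3]
  ring

theorem unique (hf : HasFourierTransform f h) (hg : HasFourierTransform f k) :
    h =ᵐ[volume] k := by
  have h0 := (hf.add (hg.smul (-1))).congr (g := 0)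
    (.of_forall fun x => by simp) .rfl
  filter_upwards [h0.ae_eq_zero] with x hx
  simp only [Pi.add_apply, Pi.zero_apply, Pi.smul_apply, smul_eq_mul] at hx
  linear_combination hx

theorem of_integrable (hf : Integrable f) : HasFourierTransform f (fourierIntegralRd f) := by
  have h0 := fourierL2Rd_smul 0 (0 : Lp ℂ 2 (volume : Measure (EuclideanSpace ℝ (Fin d))))
  refine (of_add hf 0).congr ?_ ?_
  · filter_upwards [Lp.coeFn_zero ℂ 2 (volume : Measure (EuclideanSpace ℝ (Fin d)))] with x hx
    rw [Pi.add_apply, hx, Pi.zero_apply, add_zero]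
  · filter_upwards [h0] with x hx
    simp only [smul_zero, Pi.smul_apply, zero_smul] at hx
    simp [hx]

theorem aestronglyMeasurable (hf : HasFourierTransform f h) : AEStronglyMeasurable h volume := by
  obtain ⟨u, v, hu, -, hh⟩ := hf
  have hcont : Continuous (𝓕 u) := by
    refine VectorFourier.fourierIntegral_continuous Real.continuous_fourierChar ?_ hu
    exact continuous_inner
  have : fourierIntegralRd u = fun x => 𝓕 u ((2 * Real.pi)⁻¹ • x) :=
    funext (fourierIntegralRd_eq_fourier u)
  refine AEStronglyMeasurable.congr ?_ hh.symm
  rw [this]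
  exact (Continuous.aestronglyMeasurable (by fun_prop)).add (aestronglyMeasurable_fourierL2Rd v)

end HasFourierTransform

end FourierExtension

/-! ### The bounded operator from L^p to L^{p',p}: existence and uniqueness. -/

section FourierLorentz

variable {d : ℕ} {p p' : ℝ}

theorem lintegral_enorm_rpow_eq_eLpNorm_rpow {α : Type*} [MeasurableSpace α] {μ : Measure α}
    (hp : 0 < p) (f : α → ℂ) :
    ∫⁻ x, ‖f x‖ₑ ^ p ∂μ = eLpNorm f (ENNReal.ofReal p) μ ^ p := by
  rw [eLpNorm_eq_lintegral_rpow_enorm_toReal (by simpa using hp) (by simp),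
    ENNReal.toReal_ofReal hp.le, ← ENNReal.rpow_mul, one_div, inv_mul_cancel₀ hp.ne',
    ENNReal.rpow_one]

theorem lintegral_enorm_rpow_eq_enorm_Lp {α : Type*} [MeasurableSpace α] {μ : Measure α}
    (hp : 0 < p) (f : Lp ℂ (ENNReal.ofReal p) μ) :
    ∫⁻ x, ‖f x‖ₑ ^ p ∂μ = ‖f‖ₑ ^ p := by
  rw [lintegral_enorm_rpow_eq_eLpNorm_rpow hp, Lp.enorm_def]

/-- Cutting at height s puts the large values in L¹ and the small ones in L², because 1 < p < 2. The
exact values of both norms are kept, since the interpolation integrates them over s. -/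
theorem exists_truncation {α : Type*} [MeasurableSpace α] {μ : Measure α} (hp1 : 1 < p)
    (hp2 : p < 2) {f : α → ℂ} (hf : Measurable f)
    (hfp : ∫⁻ x, ‖f x‖ₑ ^ p ∂μ ≠ ⊤) {s : ℝ} (hs : 0 < s) :
    ∃ (u : α → ℂ) (v : Lp ℂ 2 μ), Integrable u μ ∧ f =ᵐ[μ] u + (v : α → ℂ) ∧
      ∫⁻ x, ‖u x‖ₑ ∂μ = ∫⁻ y in {y | s < ‖f y‖}, ‖f y‖ₑ ∂μ ∧
      ∫⁻ x, ‖v x‖ₑ ^ 2 ∂μ = ∫⁻ y in {y | ‖f y‖ ≤ s}, ‖f y‖ₑ ^ 2 ∂μ := by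
  have hm : MeasurableSet {x | s < ‖f x‖} := measurableSet_lt measurable_const hf.norm
  have hm' : MeasurableSet {x | ‖f x‖ ≤ s} := measurableSet_le hf.norm measurable_const
  set u := {x | s < ‖f x‖}.indicator f
  set w := {x | ‖f x‖ ≤ s}.indicator f
  have hu : ∫⁻ x, ‖u x‖ₑ ∂μ = ∫⁻ y in {y | s < ‖f y‖}, ‖f y‖ₑ ∂μ := by
    rw [← lintegral_indicator hm]
    refine lintegral_congr fun x => ?_
    by_cases hx : x ∈ {x | s < ‖f x‖} <;> simp [u, hx]
  have hw : ∫⁻ x, ‖w x‖ₑ ^ 2 ∂μ = ∫⁻ y in {y | ‖f y‖ ≤ s}, ‖f y‖ₑ ^ 2 ∂μ := by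
    rw [← lintegral_indicator hm']
    refine lintegral_congr fun x => ?_
    by_cases hx : x ∈ {x | ‖f x‖ ≤ s} <;> simp [w, hx]
  have hwL : MemLp w 2 μ := by
    refine ⟨(hf.indicator hm').aestronglyMeasurable, ?_⟩
    rw [eLpNorm_lt_top_iff_lintegral_rpow_enorm_lt_top (by simp) (by simp)]
    simp only [ENNReal.toReal_ofNat, ENNReal.rpow_ofNat]
    rw [hw]
    exact (setLIntegral_sq_le_le_mul_lintegral_rpow hf hp1.le hp2 hs).trans_lt
      (ENNReal.mul_lt_top ENNReal.ofReal_lt_top hfp.lt_top)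
  refine ⟨u, hwL.toLp w, ⟨(hf.indicator hm).aestronglyMeasurable, ?_⟩, ?_, hu, ?_⟩
  · rw [hasFiniteIntegral_iff_enorm, hu]
    exact (setLIntegral_gt_le_mul_lintegral_rpow hf hp1 hs).trans_lt
      (ENNReal.mul_lt_top ENNReal.ofReal_lt_top hfp.lt_top)
  · filter_upwards [hwL.coeFn_toLp] with x hx
    rw [Pi.add_apply, hx]
    by_cases h : s < ‖f x‖
    · simp [u, w, h, not_le.2 h]
    · simp [u, w, h, not_lt.1 h]
  · rw [← hw]
    refine lintegral_congr_ae ?_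
    filter_upwards [hwL.coeFn_toLp] with x hx
    rw [hx]

/-- The constant in the Hausdorff–Young–Paley inequality. -/
def paleyConst (d : ℕ) (p : ℝ) : ℝ≥0∞ :=
  ENNReal.ofReal (16 / (p - 1)) +
    ENNReal.ofReal (4 / (2 - p)) * ENNReal.ofReal ((2 * Real.pi) ^ d)

theorem paleyConst_ne_top (d : ℕ) (p : ℝ) : paleyConst d p ≠ ⊤ := by
  simp [paleyConst, ENNReal.mul_ne_top]

/-- The Hausdorff–Young–Paley inequality. -/
theorem lorentzIntegral_fourier_le (hp1 : 1 < p) (hp2 : p < 2) (hpp' : p.HolderConjugate p')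
    {f h : EuclideanSpace ℝ (Fin d) → ℂ} (hf : Measurable f)
    (hfp : ∫⁻ x, ‖f x‖ₑ ^ p ≠ ⊤) (hh : Measurable h) (hfh : HasFourierTransform f h) :
    lorentzIntegral p' p volume h ≤ paleyConst d p * ∫⁻ x, ‖f x‖ₑ ^ p := by
  refine lorentzIntegral_le_of_decomposition hp1 hp2 hpp' hf hfp hh ENNReal.ofReal_ne_top
    fun s hs => ?_
  obtain ⟨u, v, hu, hfuv, hu1, hv2⟩ := exists_truncation hp1 hp2 hf hfp hs
  refine ⟨fourierIntegralRd u, fourierL2Rd v, (aestronglyMeasurable_fourierL2Rd v).aemeasurable,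
    hfh.unique ((HasFourierTransform.of_add hu v).congr hfuv.symm .rfl), ?_, ?_⟩
  · refine .of_forall fun x => ?_
    rw [← hu1]
    exact enorm_fourierIntegralRd_le u x
  · rw [lintegral_enorm_fourierL2Rd_sq, hv2]

theorem Lp_lintegral_rpow_ne_top (hp : 0 < p)
    (f : Lp ℂ (ENNReal.ofReal p) (volume : Measure (EuclideanSpace ℝ (Fin d)))) :
    ∫⁻ x, ‖f x‖ₑ ^ p ≠ ⊤ := by
  rw [lintegral_enorm_rpow_eq_enorm_Lp hp]
  exact ENNReal.rpow_ne_top_of_nonneg hp.le enorm_ne_top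

theorem exists_hasFourierTransform (hp1 : 1 < p) (hp2 : p < 2)
    (f : Lp ℂ (ENNReal.ofReal p) (volume : Measure (EuclideanSpace ℝ (Fin d)))) :
    ∃ h : EuclideanSpace ℝ (Fin d) →ₘ[volume] ℂ, HasFourierTransform f h := by
  -- The truncation level 1 is arbitrary.
  obtain ⟨u, v, hu, hfuv, -, -⟩ := exists_truncation hp1 hp2 (Lp.stronglyMeasurable f).measurable
    (Lp_lintegral_rpow_ne_top (by linarith) f) one_pos
  have h := (HasFourierTransform.of_add hu v).congr hfuv.symm .rfl
  exact ⟨AEEqFun.mk _ h.aestronglyMeasurable, h.congr .rfl (AEEqFun.coeFn_mk _ _).symm⟩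

theorem lorentzIntegral_fourier_Lp_le (hp1 : 1 < p) (hp2 : p < 2) (hpp' : p.HolderConjugate p')
    (f : Lp ℂ (ENNReal.ofReal p) (volume : Measure (EuclideanSpace ℝ (Fin d))))
    {h : EuclideanSpace ℝ (Fin d) →ₘ[volume] ℂ} (hfh : HasFourierTransform f h) :
    lorentzIntegral p' p volume h ≤ paleyConst d p * ‖f‖ₑ ^ p := by
  rw [← lintegral_enorm_rpow_eq_enorm_Lp (by linarith)]
  exact lorentzIntegral_fourier_le hp1 hp2 hpp' (Lp.stronglyMeasurable f).measurable
    (Lp_lintegral_rpow_ne_top (by linarith) f) h.measurable hfh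

/-- The Fourier transform as a linear map from `L^p` to `L^{p',p}`. -/
def fourierLorentz (d : ℕ) (hp1 : 1 < p) (hp2 : p < 2) (hpp' : p.HolderConjugate p') :
    Lp ℂ (ENNReal.ofReal p) (volume : Measure (EuclideanSpace ℝ (Fin d))) →ₗ[ℂ]
      LorentzSpace p' p hpp'.symm.pos hpp'.pos
        (volume : Measure (EuclideanSpace ℝ (Fin d))) where
  toFun f := ⟨(exists_hasFourierTransform hp1 hp2 f).choose, by
    change lorentzENorm _ _ _ _ < ⊤
    rw [lorentzENorm_lt_top_iff hpp'.symm.pos hpp'.pos]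
    refine (lorentzIntegral_fourier_Lp_le hp1 hp2 hpp' f
      (exists_hasFourierTransform hp1 hp2 f).choose_spec).trans_lt ?_
    exact ENNReal.mul_lt_top (paleyConst_ne_top d p).lt_top
      (ENNReal.rpow_lt_top_of_nonneg hpp'.pos.le enorm_ne_top)⟩
  -- Transforms were chosen separately for each function; linearity is recovered from uniqueness.
  map_add' f g := Subtype.ext <| AEEqFun.ext <|
    (exists_hasFourierTransform hp1 hp2 (f + g)).choose_spec.unique <|
      ((exists_hasFourierTransform hp1 hp2 f).choose_spec.add
        (exists_hasFourierTransform hp1 hp2 g).choose_spec).congr (Lp.coeFn_add f g).symm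
        (AEEqFun.coeFn_add _ _).symm
  map_smul' c f := Subtype.ext <| AEEqFun.ext <|
    (exists_hasFourierTransform hp1 hp2 (c • f)).choose_spec.unique <|
      ((exists_hasFourierTransform hp1 hp2 f).choose_spec.smul c).congr (Lp.coeFn_smul c f).symm
        (AEEqFun.coeFn_smul _ _).symm

theorem hasFourierTransform_fourierLorentz (hp1 : 1 < p) (hp2 : p < 2)
    (hpp' : p.HolderConjugate p')
    (f : Lp ℂ (ENNReal.ofReal p) (volume : Measure (EuclideanSpace ℝ (Fin d)))) :
    HasFourierTransform f (fourierLorentz d hp1 hp2 hpp' f : EuclideanSpace ℝ (Fin d) →ₘ[volume] ℂ) :=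
  (exists_hasFourierTransform hp1 hp2 f).choose_spec

theorem isFourierTransform_fourierLorentz (d : ℕ) [Fact (1 ≤ ENNReal.ofReal p)] (hp1 : 1 < p) (hp2 : p < 2)
    (hpp' : p.HolderConjugate p') : IsFourierTransform (fourierLorentz d hp1 hp2 hpp') where
  bounded := by
    have hp0 : 0 < p := hpp'.pos
    refine ⟨(ENNReal.ofReal (p' ^ (1 / p)) * paleyConst d p ^ (1 / p)).toReal, fun f => ?_⟩
    have h := lorentzIntegral_fourier_Lp_le hp1 hp2 hpp' f
      (hasFourierTransform_fourierLorentz hp1 hp2 hpp' f)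
    change (lorentzENorm p' p volume _).toReal ≤ _
    rw [← toReal_enorm f, ← ENNReal.toReal_mul]
    have hpi : (0 : ℝ) ≤ 1 / p := by positivity
    refine ENNReal.toReal_mono (ENNReal.mul_ne_top (ENNReal.mul_ne_top ENNReal.ofReal_ne_top
      (ENNReal.rpow_ne_top_of_nonneg hpi (paleyConst_ne_top d p))) enorm_ne_top) ?_
    unfold lorentzENorm
    rw [mul_assoc]
    gcongr
    refine (ENNReal.rpow_le_rpow h hpi).trans (le_of_eq ?_)
    rw [ENNReal.mul_rpow_of_nonneg _ _ hpi, ← ENNReal.rpow_mul, mul_one_div_cancel hp0.ne',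
      ENNReal.rpow_one]
  eq_integral f hf :=
    (hasFourierTransform_fourierLorentz hp1 hp2 hpp' f).unique (.of_integrable hf)

/-- Chebyshev's inequality for the Lorentz functional. -/
theorem mul_meas_rpow_le_lorentzIntegral {α : Type*} [MeasurableSpace α] {μ : Measure α} {q r : ℝ}
    (hq : 0 < q) (hr : 0 < r) (f : α → ℂ) {t : ℝ} (ht : 0 < t) :
    ENNReal.ofReal (t ^ r / r) * μ {x | t < ‖f x‖} ^ (r / q) ≤ lorentzIntegral q r μ f := by
  rw [← lintegral_Ioo_rpow hr ht.le, mul_comm, ← lintegral_const_mul _ (by fun_prop)]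
  refine le_trans ?_ (lintegral_mono_set (show Ioo 0 t ⊆ Ioi 0 from Ioo_subset_Ioi_self))
  refine setLIntegral_mono' measurableSet_Ioo fun s hs => ?_
  rw [mul_comm]
  gcongr
  exact hs.2.le

theorem enorm_rpow_eq_lorentzIntegral {α : Type*} [MeasurableSpace α] {μ : Measure α} {q r : ℝ}
    (hq : 0 < q) (hr : 0 < r) (f : LorentzSpace q r hq hr μ) :
    ENNReal.ofReal (‖f‖ ^ r) = ENNReal.ofReal q * lorentzIntegral q r μ (f : α →ₘ[μ] ℂ) := by
  have hf : lorentzENorm q r μ (f : α →ₘ[μ] ℂ) < ⊤ := f.2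
  change ENNReal.ofReal ((lorentzENorm q r μ (f : α →ₘ[μ] ℂ)).toReal ^ r) = _
  rw [← ENNReal.ofReal_rpow_of_nonneg ENNReal.toReal_nonneg hr.le, ENNReal.ofReal_toReal hf.ne]
  unfold lorentzENorm
  rw [ENNReal.mul_rpow_of_nonneg _ _ hr.le, ← ENNReal.rpow_mul, one_div_mul_cancel hr.ne',
    ENNReal.rpow_one, ← ENNReal.ofReal_rpow_of_pos hq, ← ENNReal.rpow_mul,
    one_div_mul_cancel hr.ne', ENNReal.rpow_one]

/-- Chebyshev turns convergence of the Lorentz functional into convergence in measure, so that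
limits can be compared without a triangle inequality for that functional. -/
theorem IsBoundedOperator.tendsto_meas {X α : Type*} [AddCommMonoid X] [Module ℂ X] [Norm X]
    [MeasurableSpace α] {μ : Measure α} {q r : ℝ} {hq : 0 < q} {hr : 0 < r}
    {T : X →ₗ[ℂ] LorentzSpace q r hq hr μ} (hT : IsBoundedOperator T) {x : ℕ → X}
    (hx : Filter.Tendsto (fun n => ‖x n‖) Filter.atTop (nhds 0)) {t : ℝ} (ht : 0 < t) :
    Filter.Tendsto (fun n => μ {y | t < ‖(T (x n) : α →ₘ[μ] ℂ) y‖}) Filter.atTop (nhds 0) := by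
  obtain ⟨C, hC⟩ := hT
  have hn : Filter.Tendsto (fun n => ‖T (x n)‖) Filter.atTop (nhds 0) := by
    refine squeeze_zero (fun n => ENNReal.toReal_nonneg) (fun n => hC (x n)) ?_
    simpa using hx.const_mul C
  set A := ENNReal.ofReal q * ENNReal.ofReal (t ^ r / r)
  have hA0 : A ≠ 0 := by
    simp only [A, ne_eq, mul_eq_zero, ENNReal.ofReal_eq_zero, not_or, not_le]
    exact ⟨hq, by positivity⟩
  have hAt : A ≠ ⊤ := ENNReal.mul_ne_top ENNReal.ofReal_ne_top ENNReal.ofReal_ne_top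
  have hbd : ∀ n, μ {y | t < ‖(T (x n) : α →ₘ[μ] ℂ) y‖} ≤
      (ENNReal.ofReal (‖T (x n)‖ ^ r) / A) ^ (q / r) := by
    intro n
    have h1 := mul_le_mul_right (mul_meas_rpow_le_lorentzIntegral (μ := μ) hq hr
      (T (x n) : α →ₘ[μ] ℂ) ht) (ENNReal.ofReal q)
    rw [← enorm_rpow_eq_lorentzIntegral hq hr, ← mul_assoc] at h1
    have h2 := (ENNReal.le_div_iff_mul_le (Or.inl hA0) (Or.inl hAt)).2 ((mul_comm _ _).trans_le h1)
    have h3 := ENNReal.rpow_le_rpow h2 (show 0 ≤ q / r by positivity)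
    rwa [← ENNReal.rpow_mul, div_mul_div_cancel₀ hq.ne', div_self hr.ne', ENNReal.rpow_one] at h3
  refine tendsto_of_tendsto_of_tendsto_of_le_of_le tendsto_const_nhds ?_ (fun n => zero_le) hbd
  have h1 : Filter.Tendsto (fun n => ENNReal.ofReal (‖T (x n)‖ ^ r)) Filter.atTop (nhds 0) := by
    have := ENNReal.tendsto_ofReal (hn.rpow_const (Or.inr hr.le))
    rwa [Real.zero_rpow hr.ne', ENNReal.ofReal_zero] at this
  have h2 := ENNReal.Tendsto.div_const h1 (Or.inr hA0)
  have h3 := (ENNReal.continuous_rpow_const (y := q / r)).continuousAt.tendsto.comp h2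
  rwa [ENNReal.zero_div, ENNReal.zero_rpow_of_pos (by positivity)] at h3

theorem exists_integrable_seq_tendsto [Fact (1 ≤ ENNReal.ofReal p)]
    (f : Lp ℂ (ENNReal.ofReal p) (volume : Measure (EuclideanSpace ℝ (Fin d)))) :
    ∃ g : ℕ → Lp ℂ (ENNReal.ofReal p) (volume : Measure (EuclideanSpace ℝ (Fin d))),
      (∀ n, Integrable (g n)) ∧ Filter.Tendsto (fun n => ‖f - g n‖) Filter.atTop (nhds 0) := by
  have hp0 : ENNReal.ofReal p ≠ 0 :=
    (zero_lt_one.trans_le (Fact.out : 1 ≤ ENNReal.ofReal p)).ne'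
  obtain ⟨x, hx, hg⟩ := mem_closure_iff_seq_limit.1 (Lp.simpleFunc.denseRange (E := ℂ)
    (μ := (volume : Measure (EuclideanSpace ℝ (Fin d)))) (p := ENNReal.ofReal p)
    ENNReal.ofReal_ne_top f)
  choose g hgx using hx
  obtain rfl : (fun n => (g n : Lp ℂ (ENNReal.ofReal p) volume)) = x := funext hgx
  refine ⟨fun n => g n, fun n => ?_, ?_⟩
  · have h := (SimpleFunc.memLp_iff_integrable hp0 ENNReal.ofReal_ne_top).1
      (Lp.simpleFunc.memLp (g n))
    exact h.congr (Lp.simpleFunc.toSimpleFunc_eq_toFun (g n))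
  · simpa using (hg.const_sub f).norm

/-- For integrable g_n → f in L^p, T g_n and S g_n are the same Fourier integral, so Tf - Sf is the
difference of T(f - g_n) and S(f - g_n), and both tend to zero in measure. -/
theorem IsFourierTransform.unique [Fact (1 ≤ ENNReal.ofReal p)] {q r : ℝ} {hq : 0 < q} {hr : 0 < r}
    {T S : Lp ℂ (ENNReal.ofReal p) (volume : Measure (EuclideanSpace ℝ (Fin d))) →ₗ[ℂ]
      LorentzSpace q r hq hr (volume : Measure (EuclideanSpace ℝ (Fin d)))}
    (hT : IsFourierTransform T) (hS : IsFourierTransform S) : T = S := by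
  ext f : 1
  obtain ⟨g, hgi, hg⟩ := exists_integrable_seq_tendsto f
  refine Subtype.ext (AEEqFun.ext ?_)
  have key : ∀ t : ℝ, 0 < t → volume {y | t < ‖(T f : EuclideanSpace ℝ (Fin d) →ₘ[volume] ℂ) y -
      (S f : EuclideanSpace ℝ (Fin d) →ₘ[volume] ℂ) y‖} = 0 := by
    intro t ht
    have h1 := (hT.bounded.tendsto_meas hg (half_pos ht)).add
      (hS.bounded.tendsto_meas hg (half_pos ht))
    rw [add_zero] at h1
    refine le_antisymm (ge_of_tendsto' h1 fun n => ?_) zero_le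
    refine le_trans (measure_mono_ae ?_) (measure_union_le _ _)
    have e (R : Lp ℂ (ENNReal.ofReal p) (volume : Measure (EuclideanSpace ℝ (Fin d))) →ₗ[ℂ]
        LorentzSpace q r hq hr (volume : Measure (EuclideanSpace ℝ (Fin d)))) :
        (R (f - g n) : EuclideanSpace ℝ (Fin d) →ₘ[volume] ℂ) =ᵐ[volume]
        (R f : EuclideanSpace ℝ (Fin d) →ₘ[volume] ℂ) -
        (R (g n) : EuclideanSpace ℝ (Fin d) →ₘ[volume] ℂ) := by
      rw [map_sub, Submodule.coe_sub]
      exact AEEqFun.coeFn_sub _ _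
    filter_upwards [e T, e S, hT.eq_integral _ (hgi n), hS.eq_integral _ (hgi n)]
      with y h1 h2 h3 h4 (hy : t < ‖_‖)
    simp only [Pi.sub_apply] at h1 h2
    by_contra hcon
    have hcon' := not_or.1 hcon
    have c1 : ¬ t / 2 < _ := hcon'.1
    have c2 : ¬ t / 2 < _ := hcon'.2
    rw [h1, not_lt] at c1
    rw [h2, not_lt] at c2
    rw [h3] at c1
    rw [h4] at c2
    have := norm_sub_le ((T f : EuclideanSpace ℝ (Fin d) →ₘ[volume] ℂ) y - fourierIntegralRd (g n) y)
      ((S f : EuclideanSpace ℝ (Fin d) →ₘ[volume] ℂ) y - fourierIntegralRd (g n) y)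
    rw [sub_sub_sub_cancel_right] at this
    linarith
  have hall : ∀ᵐ y, ∀ n : ℕ, ¬ (1 / ((n : ℝ) + 1) <
      ‖(T f : EuclideanSpace ℝ (Fin d) →ₘ[volume] ℂ) y -
        (S f : EuclideanSpace ℝ (Fin d) →ₘ[volume] ℂ) y‖) := by
    rw [ae_all_iff]
    intro n
    rw [ae_iff]
    simpa only [not_not] using key (1 / ((n : ℝ) + 1)) Nat.one_div_pos_of_nat
  filter_upwards [hall] with y hy
  by_contra hne
  obtain ⟨n, hn⟩ := exists_nat_one_div_lt (norm_pos_iff.2 (sub_ne_zero.2 hne))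
  exact hy n hn

end FourierLorentz

/-! ### Almost orthogonality in L^p, and a lower bound for Lorentz integrals. -/

section AlmostOrthogonal

theorem ENNReal.sum_rpow_le_sum_rpow {ι : Type*} (s : Finset ι) (y : ι → ℝ≥0∞) {q : ℝ}
    (hq0 : 0 < q) (hq1 : q ≤ 1) : (∑ i ∈ s, y i) ^ q ≤ ∑ i ∈ s, y i ^ q := by
  classical
  induction s using Finset.induction_on with
  | empty => simp [hq0]
  | insert i s hi ih =>
    rw [Finset.sum_insert hi, Finset.sum_insert hi]
    exact (ENNReal.rpow_add_le_add_rpow _ _ hq0.le hq1).trans (by gcongr)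

theorem ENNReal.mul_rpow_sub_one_le (x y : ℝ≥0∞) {p : ℝ} (hp : 1 ≤ p) :
    x * y ^ (p - 1) ≤ x ^ p + y ^ p := by
  have h : ∀ z : ℝ≥0∞, z * z ^ (p - 1) = z ^ p := fun z => by
    nth_rw 1 [← ENNReal.rpow_one z]
    rw [← ENNReal.rpow_add_of_nonneg _ _ zero_le_one (by linarith), add_sub_cancel]
  rcases le_total x y with hxy | hxy
  · calc x * y ^ (p - 1) ≤ y * y ^ (p - 1) := by gcongr
      _ ≤ _ := by rw [h]; exact le_add_self
  · calc x * y ^ (p - 1) ≤ x * x ^ (p - 1) := by gcongr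
      _ ≤ _ := by rw [h]; exact le_self_add

/-- An almost orthogonality principle in `L^p`, `1 < p ≤ 2`. -/
theorem lintegral_sum_rpow_le {α : Type*} [MeasurableSpace α] {μ : Measure α} {p : ℝ} (hp1 : 1 < p)
    (hp2 : p ≤ 2) {u : ℕ → α → ℝ≥0∞} (hu : ∀ n, Measurable (u n)) {K : ℕ → ℕ → ℝ≥0∞} {C : ℝ≥0∞}
    (hK : ∀ n m, ∫⁻ x, u n x * u m x ^ (p - 1) ∂μ ≤ K n m) (h1 : ∀ n, ∑' m, K n m ≤ C)
    (h2 : ∀ m, ∑' n, K n m ≤ C) (s : Finset ℕ) (y : ℕ → ℝ≥0∞) :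
    ∫⁻ x, (∑ n ∈ s, y n * u n x) ^ p ∂μ ≤ 2 * C * ∑ n ∈ s, y n ^ p := by
  -- Write z^p = z · z^{p-1} and use subadditivity of z^{p-1}, valid since p - 1 ≤ 1. What remains
  -- is a Schur test with kernel `K`, where the weak Young inequality `ENNReal.mul_rpow_sub_one_le`
  -- separates the coefficients.
  have hpt : ∀ x, (∑ n ∈ s, y n * u n x) ^ p ≤
      ∑ n ∈ s, ∑ m ∈ s, (y n * y m ^ (p - 1)) * (u n x * u m x ^ (p - 1)) := by
    intro x
    calc (∑ n ∈ s, y n * u n x) ^ p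
        = (∑ n ∈ s, y n * u n x) * (∑ n ∈ s, y n * u n x) ^ (p - 1) := by
          nth_rw 2 [← ENNReal.rpow_one (∑ n ∈ s, y n * u n x)]
          rw [← ENNReal.rpow_add_of_nonneg _ _ zero_le_one (by linarith), add_sub_cancel]
      _ ≤ (∑ n ∈ s, y n * u n x) * ∑ m ∈ s, (y m * u m x) ^ (p - 1) := by
          gcongr
          exact ENNReal.sum_rpow_le_sum_rpow _ _ (by linarith) (by linarith)
      _ = _ := by
          rw [Finset.sum_mul_sum]
          refine Finset.sum_congr rfl fun n _ => Finset.sum_congr rfl fun m _ => ?_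
          rw [ENNReal.mul_rpow_of_nonneg _ _ (by linarith)]
          ring
  have hm : ∀ n m, Measurable fun x => (y n * y m ^ (p - 1)) * (u n x * u m x ^ (p - 1)) :=
    fun n m => ((hu n).mul ((hu m).pow_const _)).const_mul _
  calc ∫⁻ x, (∑ n ∈ s, y n * u n x) ^ p ∂μ
      ≤ ∑ n ∈ s, ∑ m ∈ s, (y n * y m ^ (p - 1)) * ∫⁻ x, u n x * u m x ^ (p - 1) ∂μ := by
        refine (lintegral_mono hpt).trans (le_of_eq ?_)
        rw [lintegral_finsetSum _ fun n _ => Finset.measurable_sum _ fun m _ => hm n m]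
        refine Finset.sum_congr rfl fun n _ => ?_
        rw [lintegral_finsetSum _ fun m _ => hm n m]
        exact Finset.sum_congr rfl fun m _ =>
          lintegral_const_mul _ ((hu n).mul ((hu m).pow_const _))
    _ ≤ ∑ n ∈ s, ∑ m ∈ s, (y n ^ p * K n m + y m ^ p * K n m) := by
        gcongr with n _ m _
        rw [← add_mul]
        exact mul_le_mul' (ENNReal.mul_rpow_sub_one_le _ _ hp1.le) (hK n m)
    _ = ∑ n ∈ s, y n ^ p * ∑ m ∈ s, K n m + ∑ m ∈ s, y m ^ p * ∑ n ∈ s, K n m := by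
        simp_rw [Finset.sum_add_distrib, Finset.mul_sum]
        congr 1
        exact Finset.sum_comm
    _ ≤ ∑ n ∈ s, y n ^ p * C + ∑ m ∈ s, y m ^ p * C := by
        gcongr with n _ m _
        · exact (ENNReal.sum_le_tsum _).trans (h1 n)
        · exact (ENNReal.sum_le_tsum _).trans (h2 m)
    _ = _ := by
        rw [← Finset.sum_mul]
        ring

/-- With truncated subtraction the exponent is |n - m|, so each side of n contributes at most one
geometric series. -/
theorem tsum_pow_dist_le (θ : ℝ≥0∞) (n : ℕ) :
    ∑' m : ℕ, θ ^ (n - m + (m - n)) ≤ 2 * (1 - θ)⁻¹ := by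
  have hsplit : ∑' m : ℕ, θ ^ (n - m + (m - n)) =
      ∑ m ∈ Finset.range n, θ ^ (n - m + (m - n)) + ∑' j : ℕ, θ ^ j := by
    rw [← ENNReal.summable.sum_add_tsum_nat_add' (k := n)]
    congr 1
    refine tsum_congr fun j => ?_
    congr 1
    omega
  rw [hsplit, two_mul, ← ENNReal.tsum_geometric]
  refine add_le_add ?_ le_rfl
  calc ∑ m ∈ Finset.range n, θ ^ (n - m + (m - n))
      ≤ ∑ m ∈ Finset.range (n + 1), θ ^ (n - m + (m - n)) :=
        Finset.sum_le_sum_of_subset (Finset.range_subset_range.2 n.le_succ)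
    _ = ∑ m ∈ Finset.range (n + 1), θ ^ m := by
        rw [← Finset.sum_range_reflect]
        refine Finset.sum_congr rfl fun j hj => ?_
        have hj' := Finset.mem_range.1 hj
        congr 1
        omega
    _ ≤ _ := ENNReal.sum_le_tsum _

/-- A geometric sum is comparable to its largest term, whatever the set of indices. -/
theorem sum_pow_le_mul_of_forall_le {r : ℝ} (hr : 1 < r) (s : Finset ℕ) {X : ℝ≥0∞}
    (hX : ∀ n ∈ s, ENNReal.ofReal (r ^ n) ≤ X) :
    ∑ n ∈ s, ENNReal.ofReal (r ^ n) ≤ ENNReal.ofReal (r / (r - 1)) * X := by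
  rcases s.eq_empty_or_nonempty with rfl | hs
  · simp
  have hr' : 0 < r - 1 := by linarith
  calc ∑ n ∈ s, ENNReal.ofReal (r ^ n)
      ≤ ∑ n ∈ Finset.range (s.max' hs + 1), ENNReal.ofReal (r ^ n) :=
        Finset.sum_le_sum_of_subset fun n hn =>
          Finset.mem_range.2 (Nat.lt_succ_of_le (s.le_max' n hn))
    _ = ENNReal.ofReal ((r ^ (s.max' hs + 1) - 1) / (r - 1)) := by
        rw [← ENNReal.ofReal_sum_of_nonneg fun n _ => by positivity, geom_sum_eq hr.ne']
    _ ≤ ENNReal.ofReal (r / (r - 1) * r ^ s.max' hs) := by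
        refine ENNReal.ofReal_le_ofReal ?_
        rw [div_mul_eq_mul_div, pow_succ']
        gcongr
        linarith
    _ ≤ _ := by
        rw [ENNReal.ofReal_mul (by positivity)]
        gcongr
        exact hX _ (s.max'_mem hs)

/-- A lower bound for the Lorentz functional of a function that takes prescribed absolute values
on sets of geometrically growing measure. -/
theorem sum_le_lorentzIntegral {β : Type*} [MeasurableSpace β] {ν : Measure β} {q r : ℝ}
    (hq : 0 < q) (hr : 0 < r) {h : β → ℂ} {a : ℝ} (ha : 1 < a) {W : ℝ≥0∞} (hW0 : W ≠ 0)
    (hWt : W ≠ ⊤) (s : Finset ℕ) {B : ℕ → Set β} {y : ℕ → ℝ} (hy0 : ∀ n ∈ s, 0 ≤ y n)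
    (hB : ∀ n ∈ s, W * ENNReal.ofReal (a ^ n) ≤ ν (B n) ^ (r / q))
    (hy : ∀ n ∈ s, ∀ x ∈ B n, ‖h x‖ = y n) :
    W * ∑ n ∈ s, ENNReal.ofReal (a ^ n * (y n ^ r / r)) ≤
      ENNReal.ofReal (a / (a - 1)) * lorentzIntegral q r ν h := by
  have hrq : 0 ≤ r / q := by positivity
  unfold lorentzIntegral
  rw [← lintegral_const_mul' _ _ ENNReal.ofReal_ne_top, Finset.mul_sum]
  calc ∑ n ∈ s, W * ENNReal.ofReal (a ^ n * (y n ^ r / r))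
      = ∑ n ∈ s, ∫⁻ t in Ioi (0 : ℝ), (Iio (y n)).indicator
          (fun t => W * ENNReal.ofReal (a ^ n) * ENNReal.ofReal (t ^ (r - 1))) t := by
        refine Finset.sum_congr rfl fun n hn => ?_
        rw [lintegral_indicator measurableSet_Iio, Measure.restrict_restrict measurableSet_Iio,
          inter_comm, Ioi_inter_Iio, lintegral_const_mul _ (by fun_prop),
          lintegral_Ioo_rpow hr (hy0 n hn), ENNReal.ofReal_mul (by positivity), mul_assoc]
    _ = ∫⁻ t in Ioi (0 : ℝ), ∑ n ∈ s, (Iio (y n)).indicator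
          (fun t => W * ENNReal.ofReal (a ^ n) * ENNReal.ofReal (t ^ (r - 1))) t := by
        rw [lintegral_finsetSum _ fun n _ => Measurable.indicator (by fun_prop) measurableSet_Iio]
    _ ≤ _ := by
        refine lintegral_mono fun t => ?_
        have e : ∑ n ∈ s, (Iio (y n)).indicator
            (fun t => W * ENNReal.ofReal (a ^ n) * ENNReal.ofReal (t ^ (r - 1))) t =
            (W * ENNReal.ofReal (t ^ (r - 1))) *
              ∑ n ∈ s with t < y n, ENNReal.ofReal (a ^ n) := by
          rw [Finset.mul_sum, Finset.sum_filter]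
          refine Finset.sum_congr rfl fun n _ => ?_
          simp only [indicator_apply, mem_Iio]
          split_ifs
          · ring
          · rfl
        rw [e]
        -- Every B_n with t < y_n lies in the superlevel set {t < |h|}, so the largest of the
        -- corresponding powers, and hence their sum, is controlled by its measure. Disjointness of
        -- the B_n is not needed.
        have key := sum_pow_le_mul_of_forall_le ha (s.filter fun n => t < y n)
          (X := ν {x | t < ‖h x‖} ^ (r / q) / W) fun n hn => by
            obtain ⟨hns, hn⟩ := Finset.mem_filter.1 hn
            rw [ENNReal.le_div_iff_mul_le (Or.inl hW0) (Or.inl hWt), mul_comm]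
            refine (hB n hns).trans (ENNReal.rpow_le_rpow (measure_mono fun x hx => ?_) hrq)
            change t < ‖h x‖
            rwa [hy n hns x hx]
        calc _ ≤ W * ENNReal.ofReal (t ^ (r - 1)) *
              (ENNReal.ofReal (a / (a - 1)) * (ν {x | t < ‖h x‖} ^ (r / q) / W)) := by gcongr
          _ = ENNReal.ofReal (a / (a - 1)) * (ENNReal.ofReal (t ^ (r - 1)) *
              (W * (ν {x | t < ‖h x‖} ^ (r / q) / W))) := by ring
          _ = _ := by rw [ENNReal.mul_div_cancel hW0 hWt]

end AlmostOrthogonal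

/-! ### Lacunary dilates and their Fourier transforms. -/

section LacunaryDilates

open scoped FourierTransform SchwartzMap ContDiff

variable {d : ℕ} {p p' : ℝ}

/-- The `L^p`-normalized dilate of `f` by the factor `4 ^ n`. -/
def lacunaryDilate (p : ℝ) (f : EuclideanSpace ℝ (Fin d) → ℂ) (n : ℕ)
    (x : EuclideanSpace ℝ (Fin d)) : ℂ :=
  (((4 : ℝ) ^ n) ^ (d / p) : ℝ) * f ((4 : ℝ) ^ n • x)

theorem enorm_lacunaryDilate (p : ℝ) (f : EuclideanSpace ℝ (Fin d) → ℂ) (n : ℕ)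
    (x : EuclideanSpace ℝ (Fin d)) :
    ‖lacunaryDilate p f n x‖ₑ =
      ENNReal.ofReal ((4 : ℝ) ^ (n * (d / p))) * ‖f ((4 : ℝ) ^ n • x)‖ₑ := by
  rw [lacunaryDilate, enorm_mul, ← ofReal_norm (((_ : ℝ) : ℂ)), Complex.norm_real,
    Real.norm_of_nonneg (by positivity), Real.rpow_mul (by norm_num), Real.rpow_natCast]

theorem lintegral_comp_four_pow_smul (g : EuclideanSpace ℝ (Fin d) → ℝ≥0∞) (n : ℕ) :
    ∫⁻ x, g ((4 : ℝ) ^ n • x) = ENNReal.ofReal ((4 : ℝ) ^ (-(n * d : ℝ))) * ∫⁻ x, g x := by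
  rw [lintegral_comp_smul_euclidean (by positivity), abs_of_pos (by positivity), ← pow_mul,
    Real.rpow_neg (by norm_num)]
  norm_cast

theorem ofReal_four_rpow_le_pow {β e : ℝ} {k : ℕ} (h : e ≤ -β * k) :
    ENNReal.ofReal ((4 : ℝ) ^ e) ≤ ENNReal.ofReal ((4 : ℝ) ^ (-β)) ^ k := by
  rw [← ENNReal.ofReal_pow (by positivity), ← Real.rpow_natCast, ← Real.rpow_mul (by norm_num)]
  exact ENNReal.ofReal_le_ofReal (Real.rpow_le_rpow_of_exponent_le (by norm_num) h)

/-- The dilate with the larger index is the more concentrated one: it is integrated by a change of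
variables, while the other is replaced by its sup bound. This gives decay rate d(1 - 1/p) for m ≤ n
and d/p for n ≤ m; as p ≤ 2 the first rate is the smaller and serves for both. -/
theorem lintegral_lacunaryDilate_mul_le (hp1 : 1 < p) (hp2 : p ≤ 2)
    {f : EuclideanSpace ℝ (Fin d) → ℂ} (hf : Measurable f) {M : ℝ≥0∞} (hM : ∀ x, ‖f x‖ₑ ≤ M)
    (n m : ℕ) :
    ∫⁻ x, ‖lacunaryDilate p f n x‖ₑ * ‖lacunaryDilate p f m x‖ₑ ^ (p - 1) ≤
      (M ^ (p - 1) * (∫⁻ x, ‖f x‖ₑ) + M * ∫⁻ x, ‖f x‖ₑ ^ (p - 1)) *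
        ENNReal.ofReal ((4 : ℝ) ^ (-(d * (1 - 1 / p)))) ^ (n - m + (m - n)) := by
  have hp0 : 0 < p := by linarith
  have hq : 0 ≤ p - 1 := by linarith
  have hfe : Measurable fun x => ‖f x‖ₑ := hf.enorm
  simp_rw [enorm_lacunaryDilate, ENNReal.mul_rpow_of_nonneg _ _ hq,
    ENNReal.ofReal_rpow_of_pos (Real.rpow_pos_of_pos (show (0 : ℝ) < 4 by norm_num) _),
    ← Real.rpow_mul (show (0 : ℝ) ≤ 4 by norm_num)]
  rw [add_mul]
  rcases le_total m n with hmn | hmn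
  · refine le_trans ?_ le_self_add
    calc _ ≤ ∫⁻ x, ENNReal.ofReal ((4 : ℝ) ^ (n * (d / p))) *
            ENNReal.ofReal ((4 : ℝ) ^ (m * (d / p) * (p - 1))) * M ^ (p - 1) *
            ‖f ((4 : ℝ) ^ n • x)‖ₑ := by
          refine lintegral_mono fun x => ?_
          calc _ ≤ ENNReal.ofReal ((4 : ℝ) ^ (n * (d / p))) * ‖f ((4 : ℝ) ^ n • x)‖ₑ *
                (ENNReal.ofReal ((4 : ℝ) ^ (m * (d / p) * (p - 1))) * M ^ (p - 1)) := by
                gcongr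
                exact hM _
            _ = _ := by ring
      _ = (M ^ (p - 1) * ∫⁻ x, ‖f x‖ₑ) * ENNReal.ofReal ((4 : ℝ) ^ (n * (d / p) +
            m * (d / p) * (p - 1) + -(n * d : ℝ))) := by
          rw [lintegral_const_mul _ (by fun_prop),
            lintegral_comp_four_pow_smul (fun x => ‖f x‖ₑ), Real.rpow_add (by norm_num),
            Real.rpow_add (by norm_num), ENNReal.ofReal_mul (by positivity),
            ENNReal.ofReal_mul (by positivity)]
          ring
      _ ≤ _ := by
          gcongr
          refine ofReal_four_rpow_le_pow (le_of_eq ?_)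
          rw [Nat.sub_eq_zero_of_le hmn, add_zero, Nat.cast_sub hmn]
          field_simp
          ring
  · refine le_trans ?_ le_add_self
    calc _ ≤ ∫⁻ x, ENNReal.ofReal ((4 : ℝ) ^ (n * (d / p))) *
            ENNReal.ofReal ((4 : ℝ) ^ (m * (d / p) * (p - 1))) * M *
            ‖f ((4 : ℝ) ^ m • x)‖ₑ ^ (p - 1) := by
          refine lintegral_mono fun x => ?_
          calc _ ≤ ENNReal.ofReal ((4 : ℝ) ^ (n * (d / p))) * M *
                (ENNReal.ofReal ((4 : ℝ) ^ (m * (d / p) * (p - 1))) *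
                  ‖f ((4 : ℝ) ^ m • x)‖ₑ ^ (p - 1)) := by
                gcongr
                exact hM _
            _ = _ := by ring
      _ = (M * ∫⁻ x, ‖f x‖ₑ ^ (p - 1)) * ENNReal.ofReal ((4 : ℝ) ^ (n * (d / p) +
            m * (d / p) * (p - 1) + -(m * d : ℝ))) := by
          rw [lintegral_const_mul _ (by fun_prop),
            lintegral_comp_four_pow_smul (fun x => ‖f x‖ₑ ^ (p - 1)), Real.rpow_add (by norm_num),
            Real.rpow_add (by norm_num), ENNReal.ofReal_mul (by positivity),
            ENNReal.ofReal_mul (by positivity)]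
          ring
      _ ≤ _ := by
          gcongr
          refine ofReal_four_rpow_le_pow ?_
          rw [Nat.sub_eq_zero_of_le hmn, zero_add, Nat.cast_sub hmn]
          have h1 : (d : ℝ) * (1 - 1 / p) ≤ d / p := by
            rw [div_eq_mul_one_div (d : ℝ) p]
            gcongr
            have : 1 / 2 ≤ 1 / p := one_div_le_one_div_of_le hp0 hp2
            linarith
          have h2 : (0 : ℝ) ≤ m - n := by simpa using hmn
          have h3 := mul_le_mul_of_nonneg_right h1 h2
          have h4 : (n * (d / p) + m * (d / p) * (p - 1) + -(m * d : ℝ)) = - (d / p * (m - n)) := by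
            field_simp
            ring
          rw [h4]
          linarith

theorem measurable_lacunaryDilate (p : ℝ) {f : EuclideanSpace ℝ (Fin d) → ℂ} (hf : Measurable f)
    (n : ℕ) : Measurable (lacunaryDilate p f n) :=
  (hf.comp (measurable_const_smul _)).const_mul _

/-- The decay ratio θ = 4^{-d(1-1/p)} is less than 1 because d ≥ 1 and p > 1, so the almost
orthogonality principle applies with summable rows and columns. -/
theorem exists_lintegral_sum_lacunaryDilate_le (hd : 1 ≤ d) (hp1 : 1 < p) (hp2 : p ≤ 2)
    {f : EuclideanSpace ℝ (Fin d) → ℂ} (hf : Measurable f) {M : ℝ≥0∞} (hM : ∀ x, ‖f x‖ₑ ≤ M)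
    (hMt : M ≠ ⊤) (h1 : ∫⁻ x, ‖f x‖ₑ ≠ ⊤) (h2 : ∫⁻ x, ‖f x‖ₑ ^ (p - 1) ≠ ⊤) :
    ∃ C : ℝ≥0∞, C ≠ ⊤ ∧ ∀ (s : Finset ℕ) (a : ℕ → ℂ),
      ∫⁻ x, ‖∑ n ∈ s, a n * lacunaryDilate p f n x‖ₑ ^ p ≤ C * ∑ n ∈ s, ‖a n‖ₑ ^ p := by
  have hp0 : 0 < p := by linarith
  set D := M ^ (p - 1) * (∫⁻ x, ‖f x‖ₑ) + M * ∫⁻ x, ‖f x‖ₑ ^ (p - 1)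
  have hD : D ≠ ⊤ := ENNReal.add_ne_top.2
    ⟨ENNReal.mul_ne_top (ENNReal.rpow_ne_top_of_nonneg (by linarith) hMt) h1,
      ENNReal.mul_ne_top hMt h2⟩
  set θ := ENNReal.ofReal ((4 : ℝ) ^ (-(d * (1 - 1 / p))))
  have hθ : θ < 1 := by
    rw [ENNReal.ofReal_lt_one]
    refine Real.rpow_lt_one_of_one_lt_of_neg (by norm_num) (neg_neg_of_pos ?_)
    have : 1 / p < 1 := (div_lt_one hp0).2 hp1
    have hd' : (0 : ℝ) < d := by exact_mod_cast hd
    exact mul_pos hd' (by linarith)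
  have hθ' : (1 - θ)⁻¹ ≠ ⊤ := by
    rw [ENNReal.inv_ne_top]
    exact (tsub_pos_of_lt hθ).ne'
  refine ⟨2 * (D * (2 * (1 - θ)⁻¹)), by finiteness, fun s a => ?_⟩
  refine le_trans (lintegral_mono fun x => ?_) (lintegral_sum_rpow_le hp1 hp2
    (u := fun n x => ‖lacunaryDilate p f n x‖ₑ) (fun n => (measurable_lacunaryDilate p hf n).enorm)
    (K := fun n m => D * θ ^ (n - m + (m - n)))
    (lintegral_lacunaryDilate_mul_le hp1 hp2 hf hM) (fun n => ?_) (fun m => ?_) s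
    fun n => ‖a n‖ₑ)
  · refine ENNReal.rpow_le_rpow ((enorm_sum_le _ _).trans (le_of_eq ?_)) hp0.le
    simp_rw [enorm_mul]
  · rw [ENNReal.tsum_mul_left]
    gcongr
    exact tsum_pow_dist_le θ n
  · rw [ENNReal.tsum_mul_left]
    gcongr
    simp_rw [add_comm (_ - m)]
    exact tsum_pow_dist_le θ m

theorem integrable_lacunaryDilate (p : ℝ) {f : EuclideanSpace ℝ (Fin d) → ℂ} (hf : Integrable f)
    (n : ℕ) : Integrable (lacunaryDilate p f n) :=
  (hf.comp_smul (by positivity)).const_mul _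

theorem fourierIntegralRd_lacunaryDilate (p : ℝ) (f : EuclideanSpace ℝ (Fin d) → ℂ) (n : ℕ)
    (x : EuclideanSpace ℝ (Fin d)) :
    fourierIntegralRd (lacunaryDilate p f n) x =
      ((4 : ℝ) ^ (n * (d / p - d)) : ℝ) * fourierIntegralRd f (((4 : ℝ) ^ n)⁻¹ • x) := by
  have h4 : (0 : ℝ) < 4 ^ n := by positivity
  have h := Measure.integral_comp_smul (volume : Measure (EuclideanSpace ℝ (Fin d)))
    (fun t => f t * Complex.exp (-Complex.I * ((inner ℝ (((4 : ℝ) ^ n)⁻¹ • x) t : ℝ) : ℂ)))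
    ((4 : ℝ) ^ n)
  simp only [finrank_euclideanSpace_fin, inner_smul_left, inner_smul_right, map_inv₀, map_pow,
    conj_trivial] at h
  have hc : ∀ r : ℝ, (4 : ℝ) ^ n * ((4 ^ n)⁻¹ * r) = r := fun r => by field_simp
  simp only [hc] at h
  simp only [fourierIntegralRd, lacunaryDilate, mul_assoc]
  rw [integral_const_mul, h, abs_of_pos (by positivity), Complex.real_smul, ← mul_assoc,
    ← Complex.ofReal_mul, mul_sub, Real.rpow_sub (by norm_num), Real.rpow_mul (by norm_num),
    Real.rpow_natCast, div_eq_mul_inv]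
  simp only [inner_smul_left, map_inv₀, map_pow, conj_trivial]
  congr 3
  norm_cast
  rw [pow_mul]

theorem fourierIntegralRd_sum_mul (s : Finset ℕ) (a : ℕ → ℂ)
    {f : ℕ → EuclideanSpace ℝ (Fin d) → ℂ} (hf : ∀ n, Integrable (f n))
    (x : EuclideanSpace ℝ (Fin d)) :
    fourierIntegralRd (fun t => ∑ n ∈ s, a n * f n t) x =
      ∑ n ∈ s, a n * fourierIntegralRd (f n) x := by
  simp only [fourierIntegralRd, Finset.sum_mul, mul_assoc]
  rw [integral_finsetSum _ fun n _ => (integrable_mul_exp_inner (hf n) x).const_mul _]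
  simp_rw [integral_const_mul]

/-- Used with q = p - 1 < 1, where integrability and boundedness alone would not suffice. -/
theorem lintegral_enorm_rpow_schwartz_ne_top (f : 𝓢(EuclideanSpace ℝ (Fin d), ℂ)) {q : ℝ}
    (hq : 0 < q) : ∫⁻ x, ‖f x‖ₑ ^ q ≠ ⊤ := by
  rw [lintegral_enorm_rpow_eq_eLpNorm_rpow hq]
  exact ENNReal.rpow_ne_top_of_nonneg hq.le (f.eLpNorm_lt_top _ volume).ne

/-- A Schwartz function whose Fourier integral is one on a ball of radius `1/4` around a unit
vector `e`, up to the normalization, and vanishes outside the ball of radius `1/2`. -/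
theorem exists_schwartz_fourier_bump (e : EuclideanSpace ℝ (Fin d)) :
    ∃ f : 𝓢(EuclideanSpace ℝ (Fin d), ℂ),
      (∀ x, (2 * Real.pi)⁻¹ • x ∈ Metric.ball e (1 / 4) → fourierIntegralRd f x = 1) ∧
      ∀ x, (2 * Real.pi)⁻¹ • x ∉ Metric.ball e (1 / 2) → fourierIntegralRd f x = 0 := by
  let b : ContDiffBump e := ⟨1 / 4, 1 / 2, by norm_num, by norm_num⟩
  let G : 𝓢(EuclideanSpace ℝ (Fin d), ℂ) :=
    (show HasCompactSupport (fun x => (b x : ℂ)) from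
      b.hasCompactSupport.comp_left Complex.ofReal_zero).toSchwartzMap
      (Complex.ofRealCLM.contDiff.comp b.contDiff)
  have hG : ∀ x, fourierIntegralRd (𝓕⁻ G : 𝓢(EuclideanSpace ℝ (Fin d), ℂ)) x =
      b ((2 * Real.pi)⁻¹ • x) := by
    intro x
    rw [fourierIntegralRd_eq_fourier, ← SchwartzMap.fourier_coe,
      FourierTransform.fourier_fourierInv_eq]
    rfl
  refine ⟨𝓕⁻ G, fun x hx => ?_, fun x hx => ?_⟩
  · rw [hG, b.one_of_mem_closedBall (Metric.ball_subset_closedBall hx), Complex.ofReal_one]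
  · rw [hG, b.zero_of_le_dist (not_lt.1 hx), Complex.ofReal_zero]

end LacunaryDilates

/-! ### The span of the dilates, on which the operator is an isomorphism. -/

section NotStrictlySingular

open scoped SchwartzMap

variable {d : ℕ} {p p' : ℝ}

/-- The ball lies in the annulus 1/2 < |y| < 3/2, whose ratio of radii 3 is less than the dilation
factor 4. Hence the transforms of different dilates have disjoint supports. -/
theorem eq_of_four_pow_smul_mem_ball {e x : EuclideanSpace ℝ (Fin d)} (he : ‖e‖ = 1) {c : ℝ}
    {n m : ℕ} (hn : c • ((4 : ℝ) ^ n)⁻¹ • x ∈ Metric.ball e (1 / 2))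
    (hm : c • ((4 : ℝ) ^ m)⁻¹ • x ∈ Metric.ball e (1 / 2)) : n = m := by
  wlog hlt : n < m generalizing n m
  · rcases lt_trichotomy n m with h | h | h
    · exact this hn hm h
    · exact h
    · exact (this hm hn h).symm
  exfalso
  have hnorm : ∀ y ∈ Metric.ball e (1 / 2), 1 / 2 < ‖y‖ ∧ ‖y‖ < 3 / 2 := by
    intro y hy
    rw [mem_ball_iff_norm] at hy
    have h1 := norm_sub_norm_le y e
    have h2 := norm_sub_norm_le e y
    rw [norm_sub_rev] at h2
    constructor <;> linarith
  obtain ⟨k, rfl⟩ := Nat.exists_eq_add_of_lt hlt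
  have hr : c • ((4 : ℝ) ^ n)⁻¹ • x =
      (4 : ℝ) ^ (k + 1) • c • ((4 : ℝ) ^ (n + k + 1))⁻¹ • x := by
    simp only [smul_smul]
    congr 1
    rw [show n + k + 1 = n + (k + 1) by ring, pow_add]
    field_simp
    ring
  have h1 := (hnorm _ hn).2
  rw [hr, norm_smul, Real.norm_of_nonneg (by positivity), pow_succ] at h1
  have h2 := (hnorm _ hm).1
  have h3 : (1 : ℝ) ≤ 4 ^ k := one_le_pow₀ (by norm_num)
  nlinarith

/-- On the dilated ball where the n-th bump is one, the other bumps vanish and the sum has modulus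
|a_n| 4^{n(d/p-d)}. That set has measure V 4^{nd}, so its power p/p' = p - 1 grows like r^n with r =
4^{d(p-1)} > 1. -/
theorem exists_sum_le_lorentzIntegral_fourier (hd : 1 ≤ d) (hp1 : 1 < p)
    (hpp' : p.HolderConjugate p') {e : EuclideanSpace ℝ (Fin d)} (he : ‖e‖ = 1)
    {f : EuclideanSpace ℝ (Fin d) → ℂ}
    (hf1 : ∀ x, (2 * Real.pi)⁻¹ • x ∈ Metric.ball e (1 / 4) → fourierIntegralRd f x = 1)
    (hf0 : ∀ x, (2 * Real.pi)⁻¹ • x ∉ Metric.ball e (1 / 2) → fourierIntegralRd f x = 0) :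
    ∃ D : ℝ≥0∞, D ≠ ⊤ ∧ ∀ (s : Finset ℕ) (a : ℕ → ℂ), ∑ n ∈ s, ‖a n‖ₑ ^ p ≤
      D * lorentzIntegral p' p volume
        fun x => ∑ n ∈ s, a n * fourierIntegralRd (lacunaryDilate p f n) x := by
  have hp0 : 0 < p := by linarith
  have hpq : p / p' = p - 1 := by
    rw [div_eq_mul_inv, ← hpp'.one_sub_inv]
    field_simp
  have hd' : (0 : ℝ) < d := by exact_mod_cast hd
  set V := ENNReal.ofReal ((2 * Real.pi) ^ d) * volume (Metric.ball e (1 / 4))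
  have hV0 : V ≠ 0 := mul_ne_zero (by simp; positivity)
    (Metric.measure_ball_pos volume e (by norm_num)).ne'
  have hVt : V ≠ ⊤ := ENNReal.mul_ne_top ENNReal.ofReal_ne_top measure_ball_lt_top.ne
  set W := V ^ (p - 1)
  have hW0 : W ≠ 0 := by
    simp only [W, ne_eq, ENNReal.rpow_eq_zero_iff, hV0, hVt, false_and, or_self, not_false_eq_true]
  have hWt : W ≠ ⊤ := ENNReal.rpow_ne_top_of_nonneg (by linarith) hVt
  set r : ℝ := 4 ^ (d * (p - 1))
  have hr : 1 < r := Real.one_lt_rpow (by norm_num) (mul_pos hd' (by linarith))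
  have hE : ENNReal.ofReal (1 / p) ≠ 0 := by simpa using hp0
  refine ⟨(W * ENNReal.ofReal (1 / p))⁻¹ * ENNReal.ofReal (r / (r - 1)), ?_, fun s a => ?_⟩
  · exact ENNReal.mul_ne_top (ENNReal.inv_ne_top.2 (mul_ne_zero hW0 hE)) ENNReal.ofReal_ne_top
  have key := sum_le_lorentzIntegral (ν := (volume : Measure (EuclideanSpace ℝ (Fin d))))
    hpp'.symm.pos hp0
    (h := fun x => ∑ n ∈ s, a n * fourierIntegralRd (lacunaryDilate p f n) x) hr hW0 hWt s
    (B := fun n => (fun x => ((2 * Real.pi)⁻¹ * ((4 : ℝ) ^ n)⁻¹) • x) ⁻¹' Metric.ball e (1 / 4))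
    (y := fun n => ‖a n‖ * (4 : ℝ) ^ (n * (d / p - d))) (fun n _ => by positivity) ?_ ?_
  · have h2 : ∀ n, ENNReal.ofReal (r ^ n * ((‖a n‖ * (4 : ℝ) ^ (n * (d / p - d))) ^ p / p)) =
        ENNReal.ofReal (1 / p) * ‖a n‖ₑ ^ p := by
      intro n
      rw [← ofReal_norm, ENNReal.ofReal_rpow_of_nonneg (norm_nonneg _) hp0.le,
        ← ENNReal.ofReal_mul (by positivity)]
      congr 1
      rw [Real.mul_rpow (norm_nonneg _) (by positivity), ← Real.rpow_mul (by norm_num)]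
      -- The L^p normalization makes the growth of the measure cancel the decay of the height
      -- exactly, leaving |a_n|^p.
      have h3 : r ^ n * (4 : ℝ) ^ (n * (d / p - d) * p) = 1 := by
        rw [← Real.rpow_natCast r, ← Real.rpow_mul (by norm_num), ← Real.rpow_add (by norm_num),
          show (d * (p - 1) * n + n * (d / p - d) * p : ℝ) = 0 by field_simp; ring,
          Real.rpow_zero]
      linear_combination (‖a n‖ ^ p / p) * h3
    simp_rw [h2] at key
    rw [← Finset.mul_sum, ← mul_assoc] at key
    rw [mul_assoc]
    have := mul_le_mul_right key (W * ENNReal.ofReal (1 / p))⁻¹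
    rwa [← mul_assoc, ENNReal.inv_mul_cancel (mul_ne_zero hW0 hE)
      (ENNReal.mul_ne_top hWt ENNReal.ofReal_ne_top), one_mul] at this
  · intro n _
    rw [hpq, Measure.addHaar_preimage_smul _ (by positivity), finrank_euclideanSpace_fin, ← inv_pow,
      mul_inv, inv_inv, inv_inv, mul_pow, abs_of_pos (by positivity),
      ENNReal.ofReal_mul (by positivity), mul_right_comm,
      ENNReal.mul_rpow_of_nonneg _ _ (by linarith)]
    refine mul_le_mul' le_rfl (le_of_eq ?_)
    rw [ENNReal.ofReal_rpow_of_pos (by positivity)]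
    congr 1
    simp only [r, ← Real.rpow_natCast]
    rw [← Real.rpow_mul (by norm_num), ← Real.rpow_mul (by norm_num), ← Real.rpow_mul (by norm_num)]
    ring_nf
  · intro n hn x hx
    have hx' : (2 * Real.pi)⁻¹ • ((4 : ℝ) ^ n)⁻¹ • x ∈ Metric.ball e (1 / 4) := by
      rw [smul_smul]
      exact hx
    change ‖∑ m ∈ s, a m * fourierIntegralRd (lacunaryDilate p f m) x‖ = _
    rw [Finset.sum_eq_single_of_mem n hn, norm_mul, fourierIntegralRd_lacunaryDilate, hf1 _ hx',
      mul_one, Complex.norm_real, Real.norm_of_nonneg (by positivity)]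
    intro m _ hmn
    rw [fourierIntegralRd_lacunaryDilate, hf0, mul_zero, mul_zero]
    exact fun hm => hmn (eq_of_four_pow_smul_mem_ball he hm
      (Metric.ball_subset_ball (by norm_num) hx'))

/-- The Fourier transform from `L^p` to `L^{p',p}` is not strictly singular: it is an isomorphism
on the span of the lacunary dilates of a Schwartz function whose Fourier transform is supported in
an annulus. -/
theorem IsFourierTransform.not_isStrictlySingular [Fact (1 ≤ ENNReal.ofReal p)] (hd : 1 ≤ d)
    (hp1 : 1 < p) (hp2 : p < 2) (hpp' : p.HolderConjugate p')
    {T : Lp ℂ (ENNReal.ofReal p) (volume : Measure (EuclideanSpace ℝ (Fin d))) →ₗ[ℂ]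
      LorentzSpace p' p hpp'.symm.pos hpp'.pos (volume : Measure (EuclideanSpace ℝ (Fin d)))}
    (hT : IsFourierTransform T) : ¬ IsStrictlySingular T := by
  have hp0 : 0 < p := by linarith
  obtain ⟨e, he⟩ : ∃ e : EuclideanSpace ℝ (Fin d), ‖e‖ = 1 :=
    ⟨EuclideanSpace.single ⟨0, hd⟩ 1, by simp⟩
  obtain ⟨f, hfm, hfi, M, hfM, hrpow, hf1, hf0⟩ : ∃ f : EuclideanSpace ℝ (Fin d) → ℂ,
      Measurable f ∧ Integrable f ∧ ∃ M : ℝ, (∀ x, ‖f x‖ₑ ≤ ENNReal.ofReal M) ∧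
      (∫⁻ x, ‖f x‖ₑ ^ (p - 1) ≠ ⊤) ∧
      (∀ x, (2 * Real.pi)⁻¹ • x ∈ Metric.ball e (1 / 4) → fourierIntegralRd f x = 1) ∧
      ∀ x, (2 * Real.pi)⁻¹ • x ∉ Metric.ball e (1 / 2) → fourierIntegralRd f x = 0 := by
    obtain ⟨f, hf1, hf0⟩ := exists_schwartz_fourier_bump e
    obtain ⟨M, -, hM⟩ := f.decay 0 0
    refine ⟨f, f.continuous.measurable, f.integrable, M, fun x => ?_,
      lintegral_enorm_rpow_schwartz_ne_top f (by linarith), hf1, hf0⟩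
    rw [← ofReal_norm]
    exact ENNReal.ofReal_le_ofReal (by simpa using hM x)
  obtain ⟨D, hDt, hD⟩ := exists_sum_le_lorentzIntegral_fourier hd hp1 hpp' he hf1 hf0
  obtain ⟨C, hCt, hC⟩ := exists_lintegral_sum_lacunaryDilate_le hd hp1 hp2.le hfm hfM
    ENNReal.ofReal_ne_top hfi.2.ne hrpow
  have hLp : ∀ n, MemLp (lacunaryDilate p f n) (ENNReal.ofReal p) := fun n => by
    refine ⟨(measurable_lacunaryDilate p hfm n).aestronglyMeasurable, ?_⟩
    rw [eLpNorm_lt_top_iff_lintegral_rpow_enorm_lt_top (by simpa using hp0) (by simp),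
      ENNReal.toReal_ofReal hp0.le]
    -- The one-term case of the upper bound shows that each dilate is in L^p.
    have := hC {n} fun _ => 1
    simp only [Finset.sum_singleton, one_mul, enorm_one, ENNReal.one_rpow, mul_one] at this
    exact this.trans_lt hCt.lt_top
  let Φ := Finsupp.linearCombination ℂ fun n => (hLp n).toLp
  have hΦ : ∀ a : ℕ →₀ ℂ, Φ a =ᵐ[volume] fun x => ∑ n ∈ a.support, a n * lacunaryDilate p f n x := by
    intro a
    have hae : ∀ᵐ x, ∀ n ∈ a.support, (a n • (hLp n).toLp : Lp ℂ (ENNReal.ofReal p) volume) x =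
        a n * lacunaryDilate p f n x := by
      refine (Filter.eventually_all_finset _).2 fun n _ => ?_
      filter_upwards [Lp.coeFn_smul (a n) (hLp n).toLp, (hLp n).coeFn_toLp] with x h1 h2
      rw [h1, Pi.smul_apply, h2, smul_eq_mul]
    filter_upwards [hae, Lp.coeFn_finsetSum a.support fun n => a n • (hLp n).toLp] with x h1 h2
    refine h2.trans ?_
    rw [Finset.sum_apply]
    exact Finset.sum_congr rfl h1
  have hint : ∀ a : ℕ →₀ ℂ, Integrable (Φ a) := fun a =>
    (integrable_finsetSum _ fun n _ =>
      (integrable_lacunaryDilate p hfi n).const_mul (a n)).congr (hΦ a).symm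
  have hlow : ∀ a : ℕ →₀ ℂ, ∑ n ∈ a.support, ‖a n‖ₑ ^ p ≤
      D * (ENNReal.ofReal p')⁻¹ * ENNReal.ofReal (‖T (Φ a)‖ ^ p) := by
    intro a
    refine (hD a.support a).trans (le_of_eq ?_)
    have hp'0 : ENNReal.ofReal p' ≠ 0 := by simpa using hpp'.symm.pos
    rw [enorm_rpow_eq_lorentzIntegral, mul_assoc, ← mul_assoc _ (ENNReal.ofReal p'),
      ENNReal.inv_mul_cancel hp'0 ENNReal.ofReal_ne_top, one_mul]
    congr 1
    refine lorentzIntegral_congr_ae p' p ?_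
    refine Filter.EventuallyEq.trans (.of_eq ?_) (hT.eq_integral _ (hint a)).symm
    rw [fourierIntegralRd_congr_ae (hΦ a)]
    exact funext fun x =>
      (fourierIntegralRd_sum_mul _ _ (fun n => integrable_lacunaryDilate p hfi n) x).symm
  have hup : ∀ a : ℕ →₀ ℂ, ‖Φ a‖ₑ ^ p ≤ C * ∑ n ∈ a.support, ‖a n‖ₑ ^ p := by
    intro a
    rw [← lintegral_enorm_rpow_eq_enorm_Lp hp0]
    refine le_trans (le_of_eq (lintegral_congr_ae ?_)) (hC a.support a)
    filter_upwards [hΦ a] with x hx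
    rw [hx]
  obtain ⟨A, hA⟩ := hT.bounded
  have hinj : Function.Injective Φ := by
    rw [injective_iff_map_eq_zero]
    intro a ha
    -- The Lorentz space carries only a bare norm function, so vanishing at 0 is read off from
    -- boundedness of T. The lower bound then kills all coefficients.
    have hT0 : ‖T (Φ a)‖ = 0 := by
      refine le_antisymm ?_ ENNReal.toReal_nonneg
      have := hA (Φ a)
      rwa [ha, norm_zero, mul_zero, ← ha] at this
    have h0 := hlow a
    rw [hT0, Real.zero_rpow hp0.ne', ENNReal.ofReal_zero, mul_zero, nonpos_iff_eq_zero,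
      Finset.sum_eq_zero_iff] at h0
    ext n
    by_contra hn
    have := h0 n (Finsupp.mem_support_iff.2 hn)
    rw [ENNReal.rpow_eq_zero_iff_of_pos hp0, enorm_eq_zero] at this
    exact hn this
  rw [IsStrictlySingular, not_not]
  refine ⟨LinearMap.range Φ, fun hfin => ?_, ?_⟩
  · have h1 : Module.Finite ℂ (ℕ →₀ ℂ) :=
      Module.Finite.equiv (LinearEquiv.ofInjective Φ hinj).symm
    have h2 := (Finsupp.basisSingleOne (R := ℂ) (ι := ℕ)).linearIndependent.finite
    exact not_finite ℕ
  · set E := C * (D * (ENNReal.ofReal p')⁻¹)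
    have hEt : E ≠ ⊤ := by
      refine ENNReal.mul_ne_top hCt (ENNReal.mul_ne_top hDt (ENNReal.inv_ne_top.2 ?_))
      simpa using hpp'.symm.pos
    -- Adding 1 keeps the constant positive without checking that E is nonzero.
    have hE0 : 0 < E.toReal + 1 := by positivity
    refine ⟨((E.toReal + 1) ^ (1 / p))⁻¹, A, by positivity, ?_⟩
    rintro _ ⟨a, rfl⟩
    refine ⟨?_, hA _⟩
    have hTn : 0 ≤ ‖T (Φ a)‖ := ENNReal.toReal_nonneg
    have h1 : ‖Φ a‖ₑ ^ p ≤ E * ENNReal.ofReal (‖T (Φ a)‖ ^ p) := by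
      refine (hup a).trans ?_
      simp only [E, mul_assoc]
      gcongr
      simpa only [mul_assoc] using hlow a
    have h2 : ‖Φ a‖ ^ p ≤ (E.toReal + 1) * ‖T (Φ a)‖ ^ p := by
      have := ENNReal.toReal_mono (ENNReal.mul_ne_top hEt ENNReal.ofReal_ne_top) h1
      rw [← ENNReal.toReal_rpow, toReal_enorm, ENNReal.toReal_mul,
        ENNReal.toReal_ofReal (by positivity)] at this
      have h3 : 0 ≤ ‖T (Φ a)‖ ^ p := by positivity
      linarith
    have h3 := Real.rpow_le_rpow (by positivity) h2 (show 0 ≤ 1 / p by positivity)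
    rw [Real.mul_rpow hE0.le (by positivity), ← Real.rpow_mul (norm_nonneg _),
      ← Real.rpow_mul hTn, mul_one_div_cancel hp0.ne', Real.rpow_one, Real.rpow_one] at h3
    rwa [inv_mul_le_iff₀ (by positivity)]

end NotStrictlySingular

end

theorem mainTheorem5 (d : ℕ) (hd : 1 ≤ d) (p p' : ℝ) (hp1 : 1 < p) (hp2 : p < 2)
    (hpp' : p.HolderConjugate p') :
    (∃! T : Lp ℂ (ENNReal.ofReal p) (volume : Measure (EuclideanSpace ℝ (Fin d))) →ₗ[ℂ]
        LorentzSpace p' p hpp'.symm.pos hpp'.pos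
          (volume : Measure (EuclideanSpace ℝ (Fin d))),
      IsFourierTransform T) ∧
    ∀ T : Lp ℂ (ENNReal.ofReal p) (volume : Measure (EuclideanSpace ℝ (Fin d))) →ₗ[ℂ]
        LorentzSpace p' p hpp'.symm.pos hpp'.pos
          (volume : Measure (EuclideanSpace ℝ (Fin d))),
      IsFourierTransform T → ¬ IsStrictlySingular T := by
  have : Fact (1 ≤ ENNReal.ofReal p) := ⟨by rw [ENNReal.one_le_ofReal]; exact hp1.le⟩
  exact ⟨⟨fourierLorentz d hp1 hp2 hpp', isFourierTransform_fourierLorentz d hp1 hp2 hpp',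
    fun S hS => hS.unique (isFourierTransform_fourierLorentz d hp1 hp2 hpp')⟩,
    fun T hT => hT.not_isStrictlySingular hd hp1 hp2 hpp'⟩
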